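/- **Setting.** A transmitter harvests energy at the epochs $0=\tau_0<\tau_1<\cdots$ (a finite or infinite list without finite accumulation point), receiving energy $\mathcal E_i>0$ at $\tau_i$. Put $\mathcal E(t)=\sum_{\tau_i\le t}\mathcal E_i$ and $\mathcal E(t^-)=\sum_{\tau_i<t}\mathcal E_i$. The receiver can be on for a total time of at most $\Gamma_0>0$, all available from time $0$. Transmitting with power $p\ge 0$ while the receiver is on gives the rate $g(p)$, where $g:[0,\infty)\to[0,\infty)$ is strictly increasing and strictly concave, $g(0)=0$, $g(p)\to\infty$ as $p\to\infty$, and $g(p)/p$ is convex and strictly decreasing on $(0,\infty)$ with limit $0$ as $p\to\infty$. A policy $\{\boldsymbol p,\boldsymbol s,N\}$ consists of times $0\le s_1<\cdots<s_{N+1}$ and powers $p_1,\dots,p_N\ge 0$; it uses power $p_i$ on $[s_i,s_{i+1}]$, and the receiver is on exactly where the power is nonzero. Let $U(t)$ be the energy it uses up to time $t$. Given $B_0>0$, a policy is feasible if $\sum_i g(p_i)(s_{i+1}-s_i)=B_0$, $U(t)\le\mathcal E(t)$ for all $t\in[0,s_{N+1}]$ (the energy constraint), and $\sum_{i:p_i\ne0}(s_{i+1}-s_i)\le\Gamma_0$.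 It is optimal if it is feasible and its finish time $s_{N+1}$ is minimal among all feasible policies. It has no breaks if $p_i\neq0$ for all $i$. Policies are written so that $s_2,\dots,s_N$ are exactly the instants strictly between $s_1$ and $s_{N+1}$ at which the power changes or which are arrival epochs $\tau_k$ with $U(\tau_k)=\mathcal E(\tau_k^-)$. **The epoch $\tau_q$.** Let $\tau_n$ be the first arrival epoch with $\Gamma_0\,g(\mathcal E(\tau_n)/\Gamma_0)\ge B_0$; let $\widetilde\Gamma_0>0$ solve $\widetilde\Gamma_0\,g(\mathcal E(\tau_n)/\widetilde\Gamma_0)=B_0$, and let $p_c=\mathcal E(\tau_n)/\widetilde\Gamma_0$. Let $T_{start}\ge0$ be the earliest time such that transmitting at constant power $p_c$ on $[T_{start},T_{start}+\widetilde\Gamma_0]$ satisfies the energy constraint. Then $\tau_q$ is the first arrival epoch in this interval with $p_c(\tau_q-T_{start})=\mathcal E(\tau_q^-)$ (so $\tau_q=\tau_0=0$ if $T_{start}=0$). **Theorem.** A policy $\{\boldsymbol p,\boldsymbol s,N\}$ with no breaks that satisfies the energy constraint is optimal if and only if 1. $\sum_{i=1}^N g(p_i)(s_{i+1}-s_i)=B_0$;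 2. $p_1\le p_2\le\cdots\le p_N$; 3. for every $i\in\{2,\dots,N\}$, $s_i$ is an arrival epoch, and $U(s_i)=\mathcal E(s_i^-)$ for every $i\in\{2,\dots,N+1\}$; 4. $s_{N+1}-s_1=\Gamma_0$ if $s_1>0$, and $s_{N+1}\le\Gamma_0$ if $s_1=0$; 5. $\tau_q$ exists, and $s_j=\tau_q$ for some $j\in\{1,\dots,N+1\}$, with $U(\tau_q)=\mathcal E(\tau_q^-)$. Consequently the optimal policy with no breaks is unique: any two optimal policies with no breaks coincide. -/

import Mathlib

open Set Filter Topology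

noncomputable section

/-- Properties of the rate `g p` achieved with transmit power `p ≥ 0`. -/
structure IsRateFunction (g : ℝ → ℝ) : Prop where
  zero : g 0 = 0
  strictMonoOn : StrictMonoOn g (Ici 0)
  tendsto_atTop : Tendsto g atTop atTop
  strictConcaveOn : StrictConcaveOn ℝ (Ici 0) g
  convexOn_div : ConvexOn ℝ (Ioi 0) (fun p => g p / p)
  strictAntiOn_div : StrictAntiOn (fun p => g p / p) (Ioi 0)
  tendsto_div : Tendsto (fun p => g p / p) atTop (𝓝 0)

/-- Energy arrivals at the transmitter: a locally finite (finite or infinite) set of arrival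
epochs in `[0, ∞)`, the first of which is `0`, with a positive amount of energy at each. -/
structure EnergyArrivals where
  epochs : Set ℝ
  energy : ℝ → ℝ
  zero_mem : (0 : ℝ) ∈ epochs
  nonneg : ∀ τ ∈ epochs, 0 ≤ τ
  pos : ∀ τ ∈ epochs, 0 < energy τ
  locallyFinite : ∀ t : ℝ, (epochs ∩ Iic t).Finite

namespace EnergyArrivals

/-- `𝓔(t)`: the total energy harvested up to and including time `t`. -/
def total (A : EnergyArrivals) (t : ℝ) : ℝ :=
  ∑ᶠ τ ∈ A.epochs ∩ Iic t, A.energy τ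

/-- `𝓔(t⁻)`: the total energy harvested strictly before time `t`
(the left limit of `total` at `t`, as the arrivals are locally finite). -/
def totalBefore (A : EnergyArrivals) (t : ℝ) : ℝ :=
  ∑ᶠ τ ∈ A.epochs ∩ Iio t, A.energy τ

/-- Constant power `p` from time `a ≥ 0` to time `a + d` respects the energy constraint. -/
def ConstFeasible (A : EnergyArrivals) (p d a : ℝ) : Prop :=
  0 ≤ a ∧ ∀ t ∈ Icc a (a + d), p * (t - a) ≤ A.total t

/-- `τq` is the epoch produced by the initial constant-power policy: `τn` is the first epoch by
which enough energy has arrived to send `B₀` bits in time `Γ₀` at constant power; `d` is the time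
in which exactly `B₀` bits are sent with all of that energy, `p` the resulting power; `a` is the
earliest feasible start of this constant-power policy; and `τq` is the first epoch during it at
which the energy used equals the energy that arrived strictly before. -/
def IsInitEpoch (A : EnergyArrivals) (g : ℝ → ℝ) (B₀ Γ₀ τq : ℝ) : Prop :=
  ∃ τn d p a : ℝ,
    IsLeast {τ | τ ∈ A.epochs ∧ B₀ ≤ Γ₀ * g (A.total τ / Γ₀)} τn ∧
    0 < d ∧ d * g (A.total τn / d) = B₀ ∧
    p = A.total τn / d ∧
    IsLeast {x | A.ConstFeasible p d x} a ∧
    IsLeast {τ | τ ∈ A.epochs ∧ τ ∈ Icc a (a + d) ∧ p * (τ - a) = A.totalBefore τ} τq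

end EnergyArrivals

/-- A policy uses power `p i` between the instants `s i` and `s (i + 1)`, for `i < N`;
it starts at `s 0 ≥ 0` and finishes at `s N`. The receiver is on exactly when the power is
nonzero. -/
@[ext] structure Policy where
  N : ℕ
  p : Fin N → ℝ
  s : Fin (N + 1) → ℝ
  p_nonneg : ∀ i, 0 ≤ p i
  s_strictMono : StrictMono s
  start_nonneg : 0 ≤ s 0

namespace Policy

def start (X : Policy) : ℝ := X.s 0

def finish (X : Policy) : ℝ := X.s (Fin.last X.N)

/-- `U(t)`: the energy used by time `t`. The `i`-th summand is `p i` times the length of the part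
of `[s i, s (i + 1)]` that lies before `t`. -/
def energyUsed (X : Policy) (t : ℝ) : ℝ :=
  ∑ i : Fin X.N, X.p i * max 0 (min t (X.s i.succ) - X.s i.castSucc)

/-- The number of bits sent by the finish time. -/
def bits (X : Policy) (g : ℝ → ℝ) : ℝ :=
  ∑ i : Fin X.N, g (X.p i) * (X.s i.succ - X.s i.castSucc)

/-- The total time for which the receiver is on. -/
def onTime (X : Policy) : ℝ :=
  ∑ i : Fin X.N with X.p i ≠ 0, (X.s i.succ - X.s i.castSucc)

/-- No more energy is used than has arrived. -/
def EnergyFeasible (X : Policy) (A : EnergyArrivals) : Prop :=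
  ∀ t ∈ Icc 0 X.finish, X.energyUsed t ≤ A.total t

structure Feasible (X : Policy) (A : EnergyArrivals) (g : ℝ → ℝ) (B₀ Γ₀ : ℝ) : Prop where
  bits_eq : X.bits g = B₀
  energy : X.EnergyFeasible A
  onTime_le : X.onTime ≤ Γ₀

/-- Feasible, with the least finish time among all feasible policies (with or without breaks). -/
def IsOptimal (X : Policy) (A : EnergyArrivals) (g : ℝ → ℝ) (B₀ Γ₀ : ℝ) : Prop :=
  X.Feasible A g B₀ Γ₀ ∧ ∀ Y : Policy, Y.Feasible A g B₀ Γ₀ → X.finish ≤ Y.finish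

/-- The receiver stays on from start to finish. -/
def NoBreaks (X : Policy) : Prop := ∀ i, X.p i ≠ 0

/-- `t` is an arrival epoch at which all energy that arrived before is used up. -/
def ExhaustsAt (X : Policy) (A : EnergyArrivals) (t : ℝ) : Prop :=
  t ∈ A.epochs ∧ X.energyUsed t = A.totalBefore t

/-- The convention for writing a policy: strictly between start and finish, the listed instants
are those where the power changes together with all arrival epochs at which the energy is used
up (whether or not the power changes there). -/
structure Canonical (X : Policy) (A : EnergyArrivals) : Prop where
  change_or_exhausts : ∀ i j : Fin X.N, (j : ℕ) = i + 1 →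
    X.p i ≠ X.p j ∨ X.ExhaustsAt A (X.s j.castSucc)
  mem_of_exhausts : ∀ t ∈ Ioo X.start X.finish, X.ExhaustsAt A t → ∃ k, X.s k = t

end Policy

end

/-!
The energy used by a policy without breaks and with nondecreasing powers is a convex, piecewise
affine curve, and the conditions of the theorem say that it touches the staircase of harvested
energy at all its corners and at its end.

*Sufficiency* is Lagrangian duality. The tangent of `g` at the power used on each interval prices
energy (its slope) and receiver time (its value at `0`). Along the policy the price of energy
decreases and that of receiver time increases, so a feasible competitor, which has used at most as
much energy at every corner, sends at most as much data; if it finishes earlier it loses, as its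
receiver time is available only at the cheaper, earlier instants (`Policy.bits_sub_bits_le`). When
the policy starts after `0` and its power is constant, receiver time costs the same everywhere and
this loss vanishes. Then the corner at `τq`, which lies inside the policy, is decisive: a competitor
sending as much data must use the same power, and the energy available before and the time left
after the corner are too little for it (`Policy.bits_ne_of_constant`).

*Necessity* is by perturbation. A policy that sends more than `B₀` by the optimal finish time can be
cut off earlier (`Policy.IsOptimal.not_lt_bits`), so no feasible modification of an optimal policy
sends more data. The modifications move energy to a later interval of smaller power, move energy to
an earlier interval of smaller power when some is left over at the corner in between, raise the
last power, and lengthen the first interval to the left. For the initial epoch, the optimal policy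
starts and finishes not later than the constant-power policy of the definition, hence by convexity
runs above it (`Policy.le_energyUsed_of_constFeasible`); where the latter exhausts the energy, so
does the former. That this happens not after `τn`, hence before the optimal finish time, is
`EnergyArrivals.exists_exhausted_epoch`.

*Uniqueness*: two optimal policies without breaks have the same span, and by convexity each energy
curve is at most the other (`Policy.energyUsed_le_energyUsed`). The listed instants are then the same,
being the ends and the epochs at which the energy is exhausted.
-/

noncomputable section

/-! ### The harvested energy as a step function -/

namespace EnergyArrivals

variable (A : EnergyArrivals)

lemma finsum_energy_mono {S T : Set ℝ} (hST : S ⊆ T) (hT : T ⊆ A.epochs) (hf : T.Finite) :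
    ∑ᶠ τ ∈ S, A.energy τ ≤ ∑ᶠ τ ∈ T, A.energy τ := by
  have hS := hf.subset hST
  rw [finsum_mem_eq_finite_toFinset_sum _ hf, finsum_mem_eq_finite_toFinset_sum _ hS]
  refine Finset.sum_le_sum_of_subset_of_nonneg (by simpa using hST) fun τ hτ _ => ?_
  exact (A.pos τ (hT (by simpa using hτ))).le

lemma finite_epochs_Iio (t : ℝ) : (A.epochs ∩ Iio t).Finite :=
  (A.locallyFinite t).subset (inter_subset_inter_right _ Iio_subset_Iic_self)

lemma total_mono : Monotone A.total := fun _ t h =>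
  A.finsum_energy_mono (inter_subset_inter_right _ (Iic_subset_Iic.2 h)) inter_subset_left
    (A.locallyFinite t)

lemma totalBefore_le_total (t : ℝ) : A.totalBefore t ≤ A.total t :=
  A.finsum_energy_mono (inter_subset_inter_right _ Iio_subset_Iic_self) inter_subset_left
    (A.locallyFinite t)

lemma total_le_totalBefore {x t : ℝ} (h : x < t) : A.total x ≤ A.totalBefore t :=
  A.finsum_energy_mono (inter_subset_inter_right _ (Iic_subset_Iio.2 h)) inter_subset_left
    (A.finite_epochs_Iio t)

lemma total_eq_totalBefore_add {τ : ℝ} (hτ : τ ∈ A.epochs) :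
    A.total τ = A.totalBefore τ + A.energy τ := by
  have : A.epochs ∩ Iic τ = insert τ (A.epochs ∩ Iio τ) := by
    ext x
    simp only [mem_inter_iff, mem_Iic, mem_insert_iff, mem_Iio]
    constructor
    · rintro ⟨hx, h⟩
      rcases h.eq_or_lt with h | h
      · exact .inl h
      · exact .inr ⟨hx, h⟩
    · rintro (rfl | ⟨hx, h⟩)
      · exact ⟨hτ, le_rfl⟩
      · exact ⟨hx, h.le⟩
  rw [total, this, finsum_mem_insert _ (by simp) (A.finite_epochs_Iio τ), add_comm]
  rfl

lemma totalBefore_zero : A.totalBefore 0 = 0 := by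
  have : A.epochs ∩ Iio 0 = ∅ := by
    ext x
    simp only [mem_inter_iff, mem_Iio, mem_empty_iff_false, iff_false, not_and, not_lt]
    exact A.nonneg x
  rw [totalBefore, this, finsum_mem_empty]

lemma total_pos {t : ℝ} (ht : 0 ≤ t) : 0 < A.total t := by
  have h := A.total_eq_totalBefore_add A.zero_mem
  rw [totalBefore_zero, zero_add] at h
  exact (h ▸ A.pos 0 A.zero_mem).trans_le (A.total_mono ht)

lemma totalBefore_pos {t : ℝ} (ht : 0 < t) : 0 < A.totalBefore t :=
  (A.total_pos le_rfl).trans_le (A.total_le_totalBefore ht)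

/-- Up to any later instant `b`, the energy stays at `𝓔(t)` until the next epoch or until `b`. -/
lemma exists_totalBefore_eq_total {t b : ℝ} (h : t < b) :
    ∃ c, t < c ∧ c ≤ b ∧ (c ∈ A.epochs ∨ c = b) ∧ A.totalBefore c = A.total t := by
  obtain ⟨c, htc, hcb, hc, hno⟩ : ∃ c, t < c ∧ c ≤ b ∧ (c ∈ A.epochs ∨ c = b) ∧
      ∀ τ ∈ A.epochs, τ < c → τ ≤ t := by
    rcases (A.epochs ∩ Ioo t b).eq_empty_or_nonempty with he | hne
    · refine ⟨b, h, le_rfl, .inr rfl, fun τ hτ hτb => ?_⟩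
      by_contra! hlt
      exact (he ▸ (⟨hτ, hlt, hτb⟩ : τ ∈ A.epochs ∩ Ioo t b) : τ ∈ (∅ : Set ℝ))
    · have hf : (A.epochs ∩ Ioo t b).Finite :=
        (A.locallyFinite b).subset (inter_subset_inter_right _ fun x hx => hx.2.le)
      obtain ⟨c, ⟨hc, htc, hcb⟩, hmin⟩ := exists_min_image _ id hf hne
      refine ⟨c, htc, hcb.le, .inl hc, fun τ hτ hτc => ?_⟩
      by_contra! hlt
      exact (hmin τ ⟨hτ, hlt, hτc.trans hcb⟩).not_gt hτc
  refine ⟨c, htc, hcb, hc, ?_⟩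
  have : A.epochs ∩ Iio c = A.epochs ∩ Iic t := by
    ext τ
    exact ⟨fun ⟨h1, h2⟩ => ⟨h1, hno τ h1 h2⟩, fun ⟨h1, h2⟩ => ⟨h1, lt_of_le_of_lt h2 htc⟩⟩
  rw [totalBefore, this, total]

/-- The energy that has arrived strictly before `t > 0` is the total at the last epoch before
`t`. -/
lemma exists_total_eq_totalBefore {t : ℝ} (h : 0 < t) :
    ∃ τ ∈ A.epochs, 0 ≤ τ ∧ τ < t ∧ ∀ x, τ ≤ x → x < t → A.total x = A.totalBefore t := by
  obtain ⟨τ, ⟨hτ, hτt⟩, hmax⟩ :=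
    exists_max_image _ id (A.finite_epochs_Iio t) ⟨0, A.zero_mem, h⟩
  refine ⟨τ, hτ, A.nonneg τ hτ, hτt, fun x hx hxt => ?_⟩
  have : A.epochs ∩ Iio t = A.epochs ∩ Iic x := by
    ext σ
    exact ⟨fun hσ => ⟨hσ.1, (hmax σ hσ).trans hx⟩, fun hσ => ⟨hσ.1, lt_of_le_of_lt hσ.2 hxt⟩⟩
  rw [totalBefore, this, total]

lemma le_total_of_forall_epoch {t b c : ℝ} (h : t < b)
    (hτ : ∀ τ ∈ A.epochs, t < τ → τ < b → c ≤ A.totalBefore τ) (hb : c ≤ A.totalBefore b) :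
    c ≤ A.total t := by
  obtain ⟨x, htx, hxb, hx, he⟩ := A.exists_totalBefore_eq_total h
  rw [← he]
  rcases hxb.eq_or_lt with rfl | hlt
  · exact hb
  · exact hτ x (hx.resolve_right hlt.ne) htx hlt

lemma exists_isLeast {S : Set ℝ} (hS : S ⊆ A.epochs) (hne : S.Nonempty) : ∃ τ, IsLeast S τ := by
  obtain ⟨b, hb⟩ := hne
  have hf : (S ∩ Iic b).Finite := (A.locallyFinite b).subset (inter_subset_inter_left _ hS)
  obtain ⟨τ, ⟨hτ, hτb⟩, hmin⟩ := exists_min_image _ id hf ⟨b, hb, mem_Iic.2 le_rfl⟩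
  refine ⟨τ, hτ, fun σ hσ => ?_⟩
  rcases le_total σ b with h | h
  · exact hmin σ ⟨hσ, h⟩
  · exact hτb.trans h

/-- Finitely many strict inequalities at the epochs up to `b` leave a common margin. -/
lemma exists_slack {P : ℝ → Prop} {W : ℝ → ℝ} (b : ℝ)
    (h : ∀ τ ∈ A.epochs, τ ≤ b → P τ → W τ < A.totalBefore τ) :
    ∃ ε > 0, ∀ τ ∈ A.epochs, τ ≤ b → P τ → W τ + ε ≤ A.totalBefore τ := by
  have hf : (A.epochs ∩ Iic b ∩ {τ | P τ}).Finite := (A.locallyFinite b).subset inter_subset_left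
  rcases (A.epochs ∩ Iic b ∩ {τ | P τ}).eq_empty_or_nonempty with he | hne
  · refine ⟨1, one_pos, fun τ hτ hb hP => ?_⟩
    exact absurd (he ▸ (⟨⟨hτ, hb⟩, hP⟩ : τ ∈ A.epochs ∩ Iic b ∩ {τ | P τ})) (notMem_empty τ)
  · obtain ⟨σ, ⟨⟨hσ, hσb⟩, hσP⟩, hmin⟩ :=
      exists_min_image _ (fun τ => A.totalBefore τ - W τ) hf hne
    refine ⟨A.totalBefore σ - W σ, sub_pos.2 (h σ hσ hσb hσP), fun τ hτ hb hP => ?_⟩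
    linarith [hmin τ ⟨⟨hτ, hb⟩, hP⟩]

end EnergyArrivals

/-! ### Tangents of the rate function -/

/-- A slope of a line through `(p, g p)` that is strictly above the graph of `g` elsewhere. As `g`
need not be differentiable, it is some choice of such a slope, arbitrary if there is none. -/
def tangentSlope (g : ℝ → ℝ) (p : ℝ) : ℝ :=
  Classical.epsilon fun l => ∀ q, 0 ≤ q → q ≠ p → g q < g p + l * (q - p)

/-- The value at `0` of the line through `(p, g p)` of slope `tangentSlope g p`: the value of one
unit of receiver time in the Lagrangian relaxation at power `p`. -/
def tangentOffset (g : ℝ → ℝ) (p : ℝ) : ℝ := g p - tangentSlope g p * p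

namespace IsRateFunction

variable {g : ℝ → ℝ}

lemma pos (hg : IsRateFunction g) {p : ℝ} (hp : 0 < p) : 0 < g p := by
  simpa [hg.zero] using hg.strictMonoOn (mem_Ici.2 le_rfl) (mem_Ici.2 hp.le) hp

lemma exists_tangent (hg : IsRateFunction g) {p : ℝ} (hp : 0 < p) :
    ∃ l, ∀ q, 0 ≤ q → q ≠ p → g q < g p + l * (q - p) := by
  -- The slope is the right derivative, as the supremum of the slopes to the right.
  have hslope : ∀ x y, 0 ≤ x → x < p → p < y → (g y - g p) / (y - p) < (g p - g x) / (p - x) :=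
    fun x y hx hxp hpy => hg.strictConcaveOn.slope_anti_adjacent (mem_Ici.2 hx)
      (mem_Ici.2 (by linarith)) hxp hpy
  set S : Set ℝ := (fun y => (g y - g p) / (y - p)) '' Ioi p with hS
  have hne : S.Nonempty := ⟨_, p + 1, by simp, rfl⟩
  have hub : ∀ x, 0 ≤ x → x < p → (g p - g x) / (p - x) ∈ upperBounds S := by
    rintro x hx hxp _ ⟨y, hy, rfl⟩
    exact (hslope x y hx hxp hy).le
  have hbdd : BddAbove S := ⟨_, hub 0 le_rfl hp⟩
  have hle : ∀ q, 0 ≤ q → q ≠ p → g q ≤ g p + sSup S * (q - p) := by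
    intro q hq hqp
    rcases lt_or_gt_of_ne hqp with h | h
    · have := csSup_le hne (hub q hq h)
      rw [le_div_iff₀ (by linarith)] at this
      linarith
    · have := le_csSup hbdd ⟨q, h, rfl⟩
      rw [div_le_iff₀ (by linarith)] at this
      linarith
  refine ⟨sSup S, fun q hq hqp => ?_⟩
  -- Strictness: compare with the midpoint of `p` and `q`.
  have h1 := hle ((1 / 2) * q + (1 / 2) * p) (by positivity) (by intro h; apply hqp; linarith)
  have h2 := hg.strictConcaveOn.2 (mem_Ici.2 hq) (mem_Ici.2 hp.le) hqp
    (by norm_num : (0 : ℝ) < 1 / 2) (by norm_num : (0 : ℝ) < 1 / 2) (by norm_num)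
  simp only [smul_eq_mul] at h2
  nlinarith

lemma lt_tangent (hg : IsRateFunction g) {p q : ℝ} (hp : 0 < p) (hq : 0 ≤ q) (h : q ≠ p) :
    g q < tangentSlope g p * q + tangentOffset g p := by
  have := Classical.epsilon_spec (hg.exists_tangent hp) q hq h
  change g q < g p + tangentSlope g p * (q - p) at this
  rw [tangentOffset]
  linarith

lemma eq_tangent (g : ℝ → ℝ) (p : ℝ) : g p = tangentSlope g p * p + tangentOffset g p := by
  rw [tangentOffset]; ring

lemma tangentSlope_pos (hg : IsRateFunction g) {p : ℝ} (hp : 0 < p) : 0 < tangentSlope g p := by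
  have h1 := hg.lt_tangent hp (by linarith : 0 ≤ p + 1) (by linarith)
  have h2 := hg.strictMonoOn (mem_Ici.2 hp.le) (mem_Ici.2 (by linarith : 0 ≤ p + 1)) (by linarith)
  have h3 := eq_tangent g p
  linarith

lemma tangentOffset_pos (hg : IsRateFunction g) {p : ℝ} (hp : 0 < p) : 0 < tangentOffset g p := by
  have := hg.lt_tangent hp le_rfl hp.ne
  rw [hg.zero] at this
  linarith

lemma tangentSlope_lt (hg : IsRateFunction g) {p q : ℝ} (hp : 0 < p) (h : p < q) :
    tangentSlope g q < tangentSlope g p := by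
  have h1 := hg.lt_tangent hp (hp.trans h).le h.ne'
  have h2 := hg.lt_tangent (hp.trans h) hp.le h.ne
  have h3 := eq_tangent g p
  have h4 := eq_tangent g q
  have : (tangentSlope g q - tangentSlope g p) * (q - p) < 0 := by linarith
  by_contra! hle
  nlinarith

lemma tangentOffset_lt (hg : IsRateFunction g) {p q : ℝ} (hp : 0 < p) (h : p < q) :
    tangentOffset g p < tangentOffset g q := by
  have h2 := hg.lt_tangent (hp.trans h) hp.le h.ne
  have h3 := eq_tangent g p
  nlinarith [hg.tangentSlope_lt hp h]

lemma tangentSlope_le (hg : IsRateFunction g) {p q : ℝ} (hp : 0 < p) (h : p ≤ q) :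
    tangentSlope g q ≤ tangentSlope g p := by
  rcases h.eq_or_lt with rfl | h
  · rfl
  · exact (hg.tangentSlope_lt hp h).le

lemma tangentOffset_le (hg : IsRateFunction g) {p q : ℝ} (hp : 0 < p) (h : p ≤ q) :
    tangentOffset g p ≤ tangentOffset g q := by
  rcases h.eq_or_lt with rfl | h
  · rfl
  · exact (hg.tangentOffset_lt hp h).le

/-- The tangent bound, with no charge for receiver time when the receiver is off. -/
lemma le_tangent (hg : IsRateFunction g) {p q : ℝ} (hp : 0 < p) (hq : 0 ≤ q) :
    g q ≤ tangentSlope g p * q + tangentOffset g p * (if q ≠ 0 then 1 else 0) := by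
  split_ifs with h
  · by_cases hqp : q = p
    · rw [hqp, mul_one, ← eq_tangent]
    · rw [mul_one]; exact (hg.lt_tangent hp hq hqp).le
  · simp only [not_not] at h
    simp [h, hg.zero]

/-- Moving an amount `e` of energy between two intervals of lengths `l` and `m` so that their
powers come closer sends more data. -/
lemma add_lt_add_of_closer (hg : IsRateFunction g) {l m x y e : ℝ} (hl : 0 < l)
    (hm : 0 < m) (hx : 0 < x) (he : 0 < e)
    (h : x + e / l ≤ y - e / m) :
    l * g x + m * g y < l * g (x + e / l) + m * g (y - e / m) := by
  have hel : 0 < e / l := by positivity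
  have hem : 0 < e / m := by positivity
  have h1 := hg.lt_tangent (by linarith : 0 < x + e / l) hx.le (by linarith)
  have h2 := hg.lt_tangent (by linarith : 0 < y - e / m) (by linarith : 0 ≤ y) (by linarith)
  have h3 := hg.tangentSlope_le (by linarith : 0 < x + e / l) h
  have h4 := eq_tangent g (x + e / l)
  have h5 := eq_tangent g (y - e / m)
  set a := tangentSlope g (x + e / l)
  set b := tangentSlope g (y - e / m)
  have h1' : l * g x < l * g (x + e / l) - a * e := by
    have : l * g x < l * (g (x + e / l) - a * (e / l)) :=
      mul_lt_mul_of_pos_left (by linarith) hl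
    calc _ < _ := this
      _ = _ := by field_simp
  have h2' : m * g y < m * g (y - e / m) + b * e := by
    have : m * g y < m * (g (y - e / m) + b * (e / m)) :=
      mul_lt_mul_of_pos_left (by linarith) hm
    calc _ < _ := this
      _ = _ := by field_simp
  nlinarith

/-- A fixed amount of energy sends more data when spread over a longer time. -/
lemma perspective_lt (hg : IsRateFunction g) {c l m : ℝ} (hc : 0 < c) (hl : 0 < l) (h : l < m) :
    l * g (c / l) < m * g (c / m) := by
  have hm := hl.trans h
  have h1 := hg.strictAntiOn_div (mem_Ioi.2 (by positivity : 0 < c / m))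
    (mem_Ioi.2 (by positivity : 0 < c / l)) (div_lt_div_of_pos_left hc hl h)
  have h2 : ∀ x, 0 < x → c * (g (c / x) / (c / x)) = x * g (c / x) := by
    intro x hx; field_simp
  have h3 := mul_lt_mul_of_pos_left h1 hc
  simpa only [h2 l hl, h2 m hm] using h3

lemma exists_perspective_eq (hg : IsRateFunction g) {c b m : ℝ} (hc : 0 < c)
    (hb : 0 < b) (hm : 0 < m)
    (h : b ≤ m * g (c / m)) : ∃ l, 0 < l ∧ l ≤ m ∧ l * g (c / l) = b := by
  have hcm : 0 < c / m := by positivity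
  have hcont : ContinuousOn (fun q => g q / q) (Ioi 0) := hg.convexOn_div.continuousOn isOpen_Ioi
  have hev : ∀ᶠ q in atTop, g q / q < b / c := hg.tendsto_div.eventually_lt_const (by positivity)
  obtain ⟨r, hr, hr'⟩ := (hev.and (eventually_ge_atTop (c / m))).exists
  obtain ⟨q, hq, hq'⟩ := intermediate_value_Icc' hr'
    (hcont.mono fun x hx => mem_Ioi.2 (hcm.trans_le hx.1))
    (show b / c ∈ Icc _ _ from ⟨hr.le, by
      rw [div_le_iff₀ hc]
      calc b ≤ _ := h
        _ = _ := by field_simp⟩)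
  have hq0 : 0 < q := hcm.trans_le hq.1
  refine ⟨c / q, by positivity, ?_, ?_⟩
  · have := hq.1
    rw [div_le_iff₀ hm] at this
    rw [div_le_iff₀ hq0]; linarith
  · have h1 : c / (c / q) = q := by field_simp
    simp only at hq'
    rw [h1]
    field_simp at hq'
    field_simp
    linarith

end IsRateFunction

/-! ### Cumulative quantities of a policy -/

lemma Fin.sum_sub_telescope {n : ℕ} (f : Fin (n + 1) → ℝ) :
    ∑ i : Fin n, (f i.succ - f i.castSucc) = f (Fin.last n) - f 0 := by
  induction n with
  | zero => simp
  | succ n ih =>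
    rw [Fin.sum_univ_castSucc]
    have := ih (fun i => f i.castSucc)
    simp only [Fin.succ_castSucc, Fin.succ_last, Fin.castSucc_zero] at this ⊢
    rw [this]; ring

namespace Policy

variable (X : Policy)

/-- The length of the part of the `i`-th interval of a policy that lies before `t`. -/
def elapsed (i : Fin X.N) (t : ℝ) : ℝ := max 0 (min t (X.s i.succ) - X.s i.castSucc)

/-- The integral of `F ∘ power` up to time `t`, outside the span of the policy counted as `0`:
energy, data and receiver time are the cases `F = id`, `F = g` and `F q = if q ≠ 0 then 1 else 0`.
-/
def cumulative (F : ℝ → ℝ) (t : ℝ) : ℝ := ∑ i, F (X.p i) * X.elapsed i t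

/-- The time for which the receiver has been on by time `t`. -/
def onTimeBy (t : ℝ) : ℝ := X.cumulative (fun q => if q ≠ 0 then 1 else 0) t

lemma castSucc_lt_succ (i : Fin X.N) : X.s i.castSucc < X.s i.succ :=
  X.s_strictMono i.castSucc_lt_succ

lemma start_le (k : Fin (X.N + 1)) : X.start ≤ X.s k := X.s_strictMono.monotone (Fin.zero_le k)

lemma le_finish (k : Fin (X.N + 1)) : X.s k ≤ X.finish := X.s_strictMono.monotone (Fin.le_last k)

lemma finish_nonneg : 0 ≤ X.finish := X.start_nonneg.trans (X.le_finish 0)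

lemma start_eq_or_pos : 0 = X.start ∨ 0 < X.start := X.start_nonneg.eq_or_lt

lemma N_pos_of_bits_ne_zero {g : ℝ → ℝ} (h : X.bits g ≠ 0) : 0 < X.N :=
  Nat.pos_of_ne_zero fun h0 => h (Finset.sum_eq_zero fun i _ => (Fin.cast h0 i).elim0)

lemma elapsed_eq_sub (i : Fin X.N) (t : ℝ) :
    X.elapsed i t = min t (X.s i.succ) - min t (X.s i.castSucc) := by
  have := X.castSucc_lt_succ i
  rw [elapsed]
  rcases le_total t (X.s i.castSucc) with h | h
  · rw [min_eq_left (h.trans this.le), min_eq_left h, max_eq_left (by linarith), sub_self]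
  · rw [min_eq_right h, max_eq_right]
    rw [sub_nonneg]; exact le_min h this.le

lemma elapsed_mono (i : Fin X.N) : Monotone (X.elapsed i) := fun _ _ h =>
  max_le_max le_rfl (sub_le_sub_right (min_le_min_right _ h) _)

lemma elapsed_nonneg (i : Fin X.N) (t : ℝ) : 0 ≤ X.elapsed i t := le_max_left _ _

lemma elapsed_le (i : Fin X.N) (t : ℝ) : X.elapsed i t ≤ X.s i.succ - X.s i.castSucc :=
  max_le (sub_nonneg.2 (X.castSucc_lt_succ i).le) (sub_le_sub_right (min_le_right _ _) _)

lemma elapsed_of_le {i : Fin X.N} {t : ℝ} (h : t ≤ X.s i.castSucc) : X.elapsed i t = 0 :=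
  max_eq_left (sub_nonpos.2 ((min_le_left _ _).trans h))

lemma elapsed_of_ge {i : Fin X.N} {t : ℝ} (h : X.s i.succ ≤ t) :
    X.elapsed i t = X.s i.succ - X.s i.castSucc := by
  rw [elapsed, min_eq_right h, max_eq_right (sub_nonneg.2 (X.castSucc_lt_succ i).le)]

lemma elapsed_of_mem {i : Fin X.N} {t : ℝ} (h : t ∈ Icc (X.s i.castSucc) (X.s i.succ)) :
    X.elapsed i t = t - X.s i.castSucc := by
  rw [elapsed, min_eq_left h.2, max_eq_right (sub_nonneg.2 h.1)]

lemma sum_elapsed (t : ℝ) : ∑ i, X.elapsed i t = min t X.finish - min t X.start := by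
  simp only [elapsed_eq_sub]
  exact Fin.sum_sub_telescope fun k => min t (X.s k)

lemma continuous_cumulative (F : ℝ → ℝ) : Continuous (X.cumulative F) := by
  unfold cumulative elapsed
  fun_prop

lemma energyUsed_eq (t : ℝ) : X.energyUsed t = X.cumulative id t := rfl

lemma cumulative_of_finish_le (F : ℝ → ℝ) {t : ℝ} (h : X.finish ≤ t) :
    X.cumulative F t = ∑ i, F (X.p i) * (X.s i.succ - X.s i.castSucc) :=
  Finset.sum_congr rfl fun i _ => by rw [X.elapsed_of_ge ((X.le_finish _).trans h)]

lemma cumulative_of_le_start (F : ℝ → ℝ) {t : ℝ} (h : t ≤ X.start) : X.cumulative F t = 0 :=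
  Finset.sum_eq_zero fun i _ => by rw [X.elapsed_of_le (h.trans (X.start_le _)), mul_zero]

lemma bits_eq (g : ℝ → ℝ) {t : ℝ} (h : X.finish ≤ t) : X.bits g = X.cumulative g t :=
  (X.cumulative_of_finish_le g h).symm

lemma onTime_eq {t : ℝ} (h : X.finish ≤ t) : X.onTime = X.onTimeBy t := by
  rw [onTimeBy, X.cumulative_of_finish_le _ h, onTime, Finset.sum_filter]
  exact Finset.sum_congr rfl fun i _ => by split_ifs <;> simp

lemma energyUsed_of_finish_le {t : ℝ} (h : X.finish ≤ t) :
    X.energyUsed t = X.energyUsed X.finish := by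
  rw [energyUsed_eq, energyUsed_eq, X.cumulative_of_finish_le _ h,
    X.cumulative_of_finish_le _ le_rfl]

lemma energyUsed_of_le_start {t : ℝ} (h : t ≤ X.start) : X.energyUsed t = 0 :=
  X.cumulative_of_le_start id h

lemma energyUsed_mono : Monotone X.energyUsed := fun _ _ h =>
  Finset.sum_le_sum fun i _ => mul_le_mul_of_nonneg_left (X.elapsed_mono i h) (X.p_nonneg i)

lemma energyUsed_nonneg (t : ℝ) : 0 ≤ X.energyUsed t :=
  Finset.sum_nonneg fun i _ => mul_nonneg (X.p_nonneg i) (X.elapsed_nonneg i t)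

lemma cumulative_sub (F : ℝ → ℝ) (a b : ℝ) : X.cumulative F b - X.cumulative F a =
    ∑ i, F (X.p i) * (X.elapsed i b - X.elapsed i a) := by
  rw [cumulative, cumulative, ← Finset.sum_sub_distrib]
  exact Finset.sum_congr rfl fun i _ => by ring

/-- A pointwise bound on the rate, affine in the power and in the receiver being on, integrates
over `[a, b]`. -/
lemma cumulative_sub_le {F : ℝ → ℝ} {l h a b : ℝ} (hab : a ≤ b)
    (hF : ∀ q, 0 ≤ q → F q ≤ l * q + h * (if q ≠ 0 then 1 else 0)) :
    X.cumulative F b - X.cumulative F a ≤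
      l * (X.energyUsed b - X.energyUsed a) + h * (X.onTimeBy b - X.onTimeBy a) := by
  rw [energyUsed_eq, energyUsed_eq, onTimeBy, onTimeBy, cumulative_sub, cumulative_sub,
    cumulative_sub, Finset.mul_sum, Finset.mul_sum, ← Finset.sum_add_distrib]
  refine Finset.sum_le_sum fun i _ => ?_
  have := mul_le_mul_of_nonneg_right (hF _ (X.p_nonneg i))
    (sub_nonneg.2 (X.elapsed_mono i hab))
  simp only [id] at this ⊢
  linarith

lemma onTimeBy_mono : Monotone X.onTimeBy := by
  intro _ _ h
  unfold onTimeBy cumulative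
  exact Finset.sum_le_sum fun i _ => mul_le_mul_of_nonneg_left (X.elapsed_mono i h)
    (by dsimp only; split_ifs <;> norm_num)

lemma onTimeBy_sub_le {a b : ℝ} (hab : a ≤ b) :
    X.onTimeBy b - X.onTimeBy a ≤ min b X.finish - min a X.finish := by
  have h1 : X.onTimeBy b - X.onTimeBy a ≤ ∑ i, (X.elapsed i b - X.elapsed i a) := by
    rw [onTimeBy, onTimeBy, cumulative_sub]
    refine Finset.sum_le_sum fun i _ => ?_
    have := sub_nonneg.2 (X.elapsed_mono i hab)
    split_ifs <;> linarith
  rw [Finset.sum_sub_distrib, sum_elapsed, sum_elapsed] at h1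
  linarith [min_le_min_right X.start hab]

lemma onTime_le_finish : X.onTime ≤ X.finish := by
  have h := X.onTimeBy_sub_le X.finish_nonneg
  rw [← X.onTime_eq le_rfl, min_self, min_eq_left X.finish_nonneg, onTimeBy,
    X.cumulative_of_le_start _ X.start_nonneg] at h
  linarith

variable {X}

lemma NoBreaks.pos (h : X.NoBreaks) (i : Fin X.N) : 0 < X.p i :=
  (X.p_nonneg i).lt_of_ne (h i).symm

lemma NoBreaks.onTime_eq (h : X.NoBreaks) : X.onTime = X.finish - X.start := by
  rw [onTime, Finset.filter_true_of_mem fun i _ => h i]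
  exact Fin.sum_sub_telescope X.s

variable (X)

lemma cumulative_of_mem (F : ℝ → ℝ) {i : Fin X.N} {t : ℝ}
    (h : t ∈ Icc (X.s i.castSucc) (X.s i.succ)) :
    X.cumulative F t = X.cumulative F (X.s i.castSucc) + F (X.p i) * (t - X.s i.castSucc) := by
  rw [← sub_eq_iff_eq_add', cumulative_sub, Finset.sum_eq_single i]
  · rw [X.elapsed_of_mem h, X.elapsed_of_le le_rfl, sub_zero]
  · intro j _ hj
    rcases lt_or_gt_of_ne hj with hj | hj
    · have : X.s j.succ ≤ X.s i.castSucc := X.s_strictMono.monotone (Fin.succ_le_castSucc_iff.2 hj)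
      rw [X.elapsed_of_ge this, X.elapsed_of_ge (this.trans h.1), sub_self, mul_zero]
    · have : X.s i.succ ≤ X.s j.castSucc := X.s_strictMono.monotone (Fin.succ_le_castSucc_iff.2 hj)
      rw [X.elapsed_of_le (h.2.trans this),
        X.elapsed_of_le ((X.castSucc_lt_succ i).le.trans this), sub_self, mul_zero]
  · simp

lemma exists_mem_Ioc {t : ℝ} (h : t ∈ Ioc X.start X.finish) :
    ∃ i : Fin X.N, t ∈ Ioc (X.s i.castSucc) (X.s i.succ) := by
  have : ∀ k : Fin (X.N + 1), t ≤ X.s k → ∃ i : Fin X.N, t ∈ Ioc (X.s i.castSucc) (X.s i.succ) := by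
    intro k
    induction k using Fin.induction with
    | zero => exact fun h0 => absurd h0 h.1.not_ge
    | succ i ih =>
      intro hi
      rcases le_or_gt t (X.s i.castSucc) with h1 | h1
      · exact ih h1
      · exact ⟨i, h1, hi⟩
  exact this _ h.2

variable {X}

/-- With nondecreasing powers the energy curve lies above the line that extends any of its
segments. -/
lemma energyUsed_support (hmono : Monotone X.p) {i : Fin X.N} {t x : ℝ}
    (ht : t ∈ Icc (X.s i.castSucc) (X.s i.succ)) (hx : x ∈ Icc X.start X.finish) :
    X.energyUsed t + X.p i * (x - t) ≤ X.energyUsed x := by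
  have ht' : t ∈ Icc X.start X.finish := ⟨(X.start_le _).trans ht.1, ht.2.trans (X.le_finish _)⟩
  have hsum : ∑ j, X.p i * (X.elapsed j x - X.elapsed j t) = X.p i * (x - t) := by
    rw [← Finset.mul_sum, Finset.sum_sub_distrib, sum_elapsed, sum_elapsed, min_eq_left hx.2,
      min_eq_right hx.1, min_eq_left ht'.2, min_eq_right ht'.1]
    ring
  rw [← hsum, ← le_sub_iff_add_le', energyUsed_eq, energyUsed_eq, cumulative_sub]
  refine Finset.sum_le_sum fun j _ => ?_
  simp only [id]
  rcases le_total t x with hxt | hxt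
  · rcases le_or_gt i j with hj | hj
    · exact mul_le_mul_of_nonneg_right (hmono hj) (sub_nonneg.2 (X.elapsed_mono j hxt))
    · have : X.s j.succ ≤ X.s i.castSucc := X.s_strictMono.monotone (Fin.succ_le_castSucc_iff.2 hj)
      rw [X.elapsed_of_ge (this.trans ht.1), X.elapsed_of_ge ((this.trans ht.1).trans hxt)]
      simp
  · rcases le_or_gt j i with hj | hj
    · exact mul_le_mul_of_nonpos_right (hmono hj) (sub_nonpos.2 (X.elapsed_mono j hxt))
    · have : X.s i.succ ≤ X.s j.castSucc := X.s_strictMono.monotone (Fin.succ_le_castSucc_iff.2 hj)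
      rw [X.elapsed_of_le (ht.2.trans this), X.elapsed_of_le ((hxt.trans ht.2).trans this)]
      simp

/-- A convex curve `W` (given by its subgradients) that is at most the energy curve of `X` at the
listed instants is so throughout, as the energy curve is affine in between. -/
lemma le_energyUsed_of_le_grid {W : ℝ → ℝ}
    (hW : ∀ t ∈ Icc X.start X.finish, ∃ m, ∀ x ∈ Icc X.start X.finish, W t + m * (x - t) ≤ W x)
    (hgrid : ∀ k, W (X.s k) ≤ X.energyUsed (X.s k)) {t : ℝ} (ht : t ∈ Icc X.start X.finish) :
    W t ≤ X.energyUsed t := by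
  rcases ht.1.eq_or_lt with h | h
  · rw [← h]; exact hgrid 0
  obtain ⟨i, hi⟩ := X.exists_mem_Ioc ⟨h, ht.2⟩
  obtain ⟨m, hm⟩ := hW t ht
  have h1 := (hm _ ⟨X.start_le i.castSucc, X.le_finish i.castSucc⟩).trans (hgrid i.castSucc)
  have h2 := (hm _ ⟨X.start_le i.succ, X.le_finish i.succ⟩).trans (hgrid i.succ)
  have e1 := X.cumulative_of_mem id (Ioc_subset_Icc_self hi)
  have e2 := X.cumulative_of_mem id (right_mem_Icc.2 (X.castSucc_lt_succ i).le)
  rw [← energyUsed_eq, ← energyUsed_eq] at e1 e2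
  simp only [id] at e1 e2
  rw [e2] at h2
  rw [e1]
  have hlt := X.castSucc_lt_succ i
  have ha : 0 < t - X.s i.castSucc := sub_pos.2 hi.1
  have hb : 0 ≤ X.s i.succ - t := sub_nonneg.2 hi.2
  by_contra! hcon
  nlinarith

/-- By continuity of the energy curve, the energy constraint holds with the energy that has
arrived strictly before. -/
lemma EnergyFeasible.le_totalBefore {A : EnergyArrivals} (h : X.EnergyFeasible A) {t : ℝ}
    (ht : 0 < t) : X.energyUsed t ≤ A.totalBefore t := by
  rcases le_or_gt t X.finish with hf | hf
  · obtain ⟨τ, -, hτ0, hτ, he⟩ := A.exists_total_eq_totalBefore ht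
    have hcont : Tendsto X.energyUsed (𝓝[<] t) (𝓝 (X.energyUsed t)) :=
      (X.continuous_cumulative id).continuousAt.mono_left nhdsWithin_le_nhds
    refine le_of_tendsto hcont ?_
    filter_upwards [Ico_mem_nhdsLT hτ] with x hx
    rw [← he x hx.1 hx.2]
    exact h x ⟨hτ0.trans hx.1, hx.2.le.trans hf⟩
  · rw [X.energyUsed_of_finish_le hf.le]
    exact (h _ (right_mem_Icc.2 X.finish_nonneg)).trans (A.total_le_totalBefore hf)

end Policy

/-! ### Optimality excludes every improvement -/

lemma Fintype.sum_eq_add_of_eq_off {ι : Type*} [Fintype ι] {f f' : ι → ℝ} (i : ι)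
    (h : ∀ m, m ≠ i → f' m = f m) : ∑ m, f' m = ∑ m, f m + (f' i - f i) := by
  rw [← sub_eq_iff_eq_add', ← Finset.sum_sub_distrib, Fintype.sum_eq_single i]
  intro m hm
  rw [h m hm, sub_self]

lemma Fintype.sum_eq_add_of_eq_off_pair {ι : Type*} [Fintype ι] {f f' : ι → ℝ} {i j : ι}
    (hij : i ≠ j) (h : ∀ m, m ≠ i → m ≠ j → f' m = f m) :
    ∑ m, f' m = ∑ m, f m + ((f' i - f i) + (f' j - f j)) := by
  rw [← sub_eq_iff_eq_add', ← Finset.sum_sub_distrib, Fintype.sum_eq_add i j hij]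
  intro m hm
  rw [h m hm.1 hm.2, sub_self]

namespace Policy

/-- The policy cut off at an instant `t` of its `k`-th interval. -/
def truncate (X : Policy) (k : Fin X.N) (t : ℝ) (ht : t ∈ Ioc (X.s k.castSucc) (X.s k.succ)) :
    Policy where
  N := k + 1
  p i := X.p (Fin.castLE k.isLt i)
  s i := min t (X.s (Fin.castLE (Nat.succ_le_succ k.isLt) i))
  p_nonneg _ := X.p_nonneg _
  s_strictMono := by
    intro i j hij
    have hi : X.s (Fin.castLE (Nat.succ_le_succ k.isLt) i) ≤ X.s k.castSucc := by
      refine X.s_strictMono.monotone ?_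
      rw [Fin.le_def]
      have := j.isLt
      rw [Fin.lt_def] at hij
      simp only [Fin.val_castLE, Fin.val_castSucc]
      omega
    refine lt_min ?_ ?_
    · exact (min_le_right _ _).trans_lt (hi.trans_lt ht.1)
    · exact (min_le_right _ _).trans_lt (X.s_strictMono (Fin.lt_def.2 (Fin.lt_def.1 hij)))
  start_nonneg := le_min (X.start_nonneg.trans ((X.start_le k.castSucc).trans ht.1.le))
    (X.start_nonneg.trans (X.start_le _))

lemma finish_truncate (X : Policy) (k : Fin X.N) (t : ℝ)
    (ht : t ∈ Ioc (X.s k.castSucc) (X.s k.succ)) : (X.truncate k t ht).finish = t :=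
  min_eq_left ht.2

lemma cumulative_truncate (X : Policy) (k : Fin X.N) (t : ℝ)
    (ht : t ∈ Ioc (X.s k.castSucc) (X.s k.succ)) (F : ℝ → ℝ) (u : ℝ) :
    (X.truncate k t ht).cumulative F u = X.cumulative F (min u t) := by
  refine Fintype.sum_of_injective (Fin.castLE k.isLt) (Fin.castLE_injective _) _ _ ?_ ?_
  · intro i hi
    have hki : k < i := by
      by_contra! hle
      exact hi ⟨⟨i, Nat.lt_succ_of_le hle⟩, rfl⟩
    rw [X.elapsed_of_le, mul_zero]
    exact (min_le_right _ _).trans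
      (ht.2.trans (X.s_strictMono.monotone (Fin.succ_le_castSucc_iff.2 hki)))
  · intro i
    refine congrArg (F _ * ·) (((X.truncate k t ht).elapsed_eq_sub i u).trans ?_)
    rw [elapsed_eq_sub, min_assoc, min_assoc]
    rfl

section Improvement

variable {X Y : Policy} {A : EnergyArrivals} {g : ℝ → ℝ} {B₀ Γ₀ : ℝ}

/-- A policy that sends more than `B₀` by the optimal finish time could be cut off earlier. -/
lemma IsOptimal.not_lt_bits (hX : X.IsOptimal A g B₀ Γ₀) (hB : 0 < B₀) (hY : Y.EnergyFeasible A)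
    (hon : Y.onTime ≤ Γ₀) (hfin : Y.finish ≤ X.finish) : ¬ B₀ < Y.bits g := by
  intro hlt
  rw [Y.bits_eq g le_rfl] at hlt
  have hsf : Y.start ≤ Y.finish := Y.le_finish 0
  obtain ⟨t, ht, hte⟩ := intermediate_value_Ioo hsf (Y.continuous_cumulative g).continuousOn
    (show B₀ ∈ Ioo _ _ from ⟨by rwa [Y.cumulative_of_le_start g le_rfl], hlt⟩)
  obtain ⟨k, hk⟩ := Y.exists_mem_Ioc (Ioo_subset_Ioc_self ht)
  have hf := Y.finish_truncate k t hk
  have hfeas : (Y.truncate k t hk).Feasible A g B₀ Γ₀ := by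
    refine ⟨?_, fun x hx => ?_, ?_⟩
    · rw [bits_eq _ g le_rfl, cumulative_truncate, hf, min_self, hte]
    · rw [hf] at hx
      rw [energyUsed_eq, cumulative_truncate, min_eq_left hx.2, ← energyUsed_eq]
      exact hY x ⟨hx.1, hx.2.trans ht.2.le⟩
    · rw [onTime_eq _ le_rfl, hf, onTimeBy, cumulative_truncate, min_self]
      exact (Y.onTimeBy_mono ht.2.le).trans ((Y.onTime_eq le_rfl).symm.le.trans hon)
  have := hX.2 _ hfeas
  rw [hf] at this
  exact absurd (this.trans_lt ht.2) hfin.not_gt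

/-- If the energy curve grows by at most `ε` inside `(u, v)`, where every epoch has a margin of
`ε`, the energy constraint survives. -/
lemma energyFeasible_of_slack {u v ε : ℝ}
    (hout : ∀ t ∈ Icc 0 Y.finish, t ≤ u ∨ v ≤ t → Y.energyUsed t ≤ A.total t)
    (hin : ∀ t, Y.energyUsed t ≤ X.energyUsed t + ε)
    (hslack : ∀ τ ∈ A.epochs, u < τ → τ < v → X.energyUsed τ + ε ≤ A.totalBefore τ)
    (hv : Y.energyUsed v ≤ A.totalBefore v) : Y.EnergyFeasible A := by
  intro t ht
  by_cases h : t ≤ u ∨ v ≤ t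
  · exact hout t ht h
  push Not at h
  refine A.le_total_of_forall_epoch h.2 (fun τ hτ h1 h2 => ?_) ?_
  · exact ((Y.energyUsed_mono h1.le).trans (hin τ)).trans (hslack τ hτ (h.1.trans h1) h2)
  · exact (Y.energyUsed_mono h.2.le).trans hv

lemma EnergyFeasible.lt_totalBefore (h : X.EnergyFeasible A) (hc : X.Canonical A) {τ : ℝ}
    (hτ : τ ∈ A.epochs) (hmem : τ ∈ Ioo X.start X.finish) (hgrid : ∀ k, X.s k = τ →
      ¬ X.ExhaustsAt A τ) : X.energyUsed τ < A.totalBefore τ := by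
  refine (h.le_totalBefore (X.start_nonneg.trans_lt hmem.1)).lt_of_ne fun he => ?_
  obtain ⟨k, hk⟩ := hc.mem_of_exhausts τ hmem ⟨hτ, he⟩
  exact hgrid k hk ⟨hτ, he⟩

lemma EnergyFeasible.lt_totalBefore_of_mem_interval (h : X.EnergyFeasible A) (hc : X.Canonical A)
    {i : Fin X.N} {τ : ℝ} (hτ : τ ∈ A.epochs) (hmem : τ ∈ Ioo (X.s i.castSucc) (X.s i.succ)) :
    X.energyUsed τ < A.totalBefore τ := by
  refine h.lt_totalBefore hc hτ
    ⟨(X.start_le _).trans_lt hmem.1, hmem.2.trans_le (X.le_finish _)⟩ fun k hk _ => ?_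
  rw [← hk] at hmem
  have h1 := X.s_strictMono.lt_iff_lt.1 hmem.1
  have h2 := X.s_strictMono.lt_iff_lt.1 hmem.2
  simp only [Fin.lt_def, Fin.val_castSucc, Fin.val_succ] at h1 h2
  omega

/-- The policy with the same instants and other powers. -/
def withPowers (X : Policy) (q : Fin X.N → ℝ) (hq : ∀ i, 0 ≤ q i) : Policy :=
  { X with p := q, p_nonneg := hq }

lemma cumulative_withPowers (X : Policy) (q : Fin X.N → ℝ) (hq : ∀ i, 0 ≤ q i) (F : ℝ → ℝ)
    (t : ℝ) : (X.withPowers q hq).cumulative F t = ∑ i, F (q i) * X.elapsed i t := rfl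

/-- The length of the `i`-th interval. -/
def length (X : Policy) (i : Fin X.N) : ℝ := X.s i.succ - X.s i.castSucc

lemma length_pos (X : Policy) (i : Fin X.N) : 0 < X.length i := sub_pos.2 (X.castSucc_lt_succ i)

/-- The powers after moving an amount `e` of energy from the `j`-th to the `i`-th interval. -/
def transfer (X : Policy) (i j : Fin X.N) (e : ℝ) : Fin X.N → ℝ :=
  Function.update (Function.update X.p j (X.p j - e / X.length j)) i (X.p i + e / X.length i)

lemma sum_transfer (X : Policy) {i j : Fin X.N} (hij : i ≠ j) (e : ℝ) (F : ℝ → ℝ)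
    (c : Fin X.N → ℝ) : ∑ m, F (X.transfer i j e m) * c m = ∑ m, F (X.p m) * c m +
      ((F (X.p i + e / X.length i) - F (X.p i)) * c i +
        (F (X.p j - e / X.length j) - F (X.p j)) * c j) := by
  rw [Fintype.sum_eq_add_of_eq_off_pair (f := fun m => F (X.p m) * c m) hij]
  · simp only [transfer, Function.update_self, Function.update_of_ne hij.symm]
    ring
  · intro m hi hj
    simp only [transfer, Function.update_of_ne hi, Function.update_of_ne hj]

/-- An optimal policy admits no feasible transfer of energy towards a smaller power. -/
lemma IsOptimal.not_feasible_transfer (hg : IsRateFunction g) (hB : 0 < B₀)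
    (hX : X.IsOptimal A g B₀ Γ₀) (hnb : X.NoBreaks) {i j : Fin X.N} {e : ℝ} (he : 0 < e)
    (hle : X.p i + e / X.length i ≤ X.p j - e / X.length j)
    (hfeas : ∀ Y : Policy, Y.finish = X.finish →
      (∀ t, Y.energyUsed t = X.energyUsed t +
        e * (X.elapsed i t / X.length i - X.elapsed j t / X.length j)) → Y.EnergyFeasible A) :
    False := by
  have hli := X.length_pos i
  have hlj := X.length_pos j
  have hi0 := hnb.pos i
  have hei : 0 < e / X.length i := by positivity
  have hej : 0 < e / X.length j := by positivity
  have hij : i ≠ j := by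
    rintro rfl
    linarith
  have hq : ∀ m, 0 < X.transfer i j e m := by
    intro m
    unfold transfer
    rcases eq_or_ne m i with rfl | hmi
    · rw [Function.update_self]; positivity
    · rw [Function.update_of_ne hmi]
      rcases eq_or_ne m j with rfl | hmj
      · rw [Function.update_self]; linarith
      · rw [Function.update_of_ne hmj]; exact hnb.pos m
  set Y := X.withPowers (X.transfer i j e) fun m => (hq m).le with hY
  have hYE : Y.EnergyFeasible A := by
    refine hfeas Y rfl fun t => ?_
    rw [energyUsed_eq, energyUsed_eq, hY, cumulative_withPowers, X.sum_transfer hij, cumulative]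
    simp only [id]
    ring
  have hYnb : Y.NoBreaks := fun m => (hq m).ne'
  have hon : Y.onTime ≤ Γ₀ := by
    rw [hYnb.onTime_eq]
    exact hnb.onTime_eq.symm.le.trans hX.1.onTime_le
  refine hX.not_lt_bits hB hYE hon le_rfl ?_
  have hb : Y.bits g = X.bits g + ((g (X.p i + e / X.length i) - g (X.p i)) * X.length i +
      (g (X.p j - e / X.length j) - g (X.p j)) * X.length j) :=
    X.sum_transfer hij e g X.length
  have := hg.add_lt_add_of_closer hli hlj hi0 he hle
  rw [hb, hX.1.bits_eq]
  linarith

lemma exists_small_transfer (X : Policy) {i j : Fin X.N} (h : X.p i < X.p j) {ε : ℝ}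
    (hε : 0 < ε) : ∃ e, 0 < e ∧ e ≤ ε ∧ X.p i + e / X.length i ≤ X.p j - e / X.length j := by
  have hli := X.length_pos i
  have hlj := X.length_pos j
  set c := 1 / X.length i + 1 / X.length j with hc
  have hc0 : 0 < c := by positivity
  refine ⟨min ε ((X.p j - X.p i) / c), lt_min hε (div_pos (sub_pos.2 h) hc0), min_le_left _ _, ?_⟩
  have h1 := min_le_right ε ((X.p j - X.p i) / c)
  rw [le_div_iff₀ hc0, hc] at h1
  set e := min ε ((X.p j - X.p i) / c)
  have : e * (1 / X.length i + 1 / X.length j) = e / X.length i + e / X.length j := by ring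
  linarith

lemma elapsed_div_length_le_one (X : Policy) (i : Fin X.N) (t : ℝ) :
    X.elapsed i t / X.length i ≤ 1 := (div_le_one (X.length_pos i)).2 (X.elapsed_le i t)

lemma elapsed_div_length_nonneg (X : Policy) (i : Fin X.N) (t : ℝ) :
    0 ≤ X.elapsed i t / X.length i := div_nonneg (X.elapsed_nonneg i t) (X.length_pos i).le

lemma elapsed_div_length_eq_one (X : Policy) {i : Fin X.N} {t : ℝ} (h : X.s i.succ ≤ t) :
    X.elapsed i t / X.length i = 1 := by
  rw [X.elapsed_of_ge h]
  exact div_self (X.length_pos i).ne'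

/-- Powers of an optimal policy do not decrease: energy can always be moved to later times. -/
lemma IsOptimal.power_le (hg : IsRateFunction g) (hB : 0 < B₀) (hX : X.IsOptimal A g B₀ Γ₀)
    (hnb : X.NoBreaks) {i j : Fin X.N} (hij : (j : ℕ) = i + 1) : X.p i ≤ X.p j := by
  by_contra! hlt
  obtain ⟨e, he, -, hle⟩ := X.exists_small_transfer hlt one_pos
  refine hX.not_feasible_transfer hg hB hnb he hle fun Y hf hY t ht => ?_
  rw [hf] at ht
  refine le_trans ?_ (hX.1.energy t ht)
  have hs : X.s i.succ = X.s j.castSucc := congrArg X.s (Fin.ext (by simp [hij]))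
  rw [hY t]
  suffices X.elapsed j t / X.length j ≤ X.elapsed i t / X.length i by nlinarith
  rcases le_total t (X.s j.castSucc) with h | h
  · rw [X.elapsed_of_le h, zero_div]
    exact X.elapsed_div_length_nonneg i t
  · rw [X.elapsed_div_length_eq_one (hs.trans_le h)]
    exact X.elapsed_div_length_le_one j t

/-- Where the power of an optimal policy changes, no energy is left over: otherwise some energy
could be used earlier, at a smaller power. -/
lemma IsOptimal.exhaustsAt (hg : IsRateFunction g) (hB : 0 < B₀) (hX : X.IsOptimal A g B₀ Γ₀)
    (hnb : X.NoBreaks) (hc : X.Canonical A) {i j : Fin X.N} (hij : (j : ℕ) = i + 1) :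
    X.ExhaustsAt A (X.s j.castSucc) := by
  by_contra hne
  have hlt : X.p i < X.p j := (hX.power_le hg hB hnb hij).lt_of_ne
    ((hc.change_or_exhausts i j hij).resolve_right hne)
  have hs : X.s i.succ = X.s j.castSucc := congrArg X.s (Fin.ext (by simp [hij]))
  obtain ⟨ε, hε, hslack⟩ := A.exists_slack (W := X.energyUsed)
    (P := fun τ => X.s i.castSucc < τ ∧ τ < X.s j.succ) (X.s j.succ) (by
      rintro τ hτ - ⟨h1, h2⟩
      rcases lt_trichotomy τ (X.s j.castSucc) with h | h | h
      · exact hX.1.energy.lt_totalBefore_of_mem_interval hc hτ ⟨h1, hs ▸ h⟩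
      · refine hX.1.energy.lt_totalBefore hc hτ
          ⟨(X.start_le _).trans_lt h1, h2.trans_le (X.le_finish _)⟩ fun _ _ => h ▸ hne
      · exact hX.1.energy.lt_totalBefore_of_mem_interval hc hτ ⟨h, h2⟩)
  obtain ⟨e, he, heε, hle⟩ := X.exists_small_transfer hlt hε
  refine hX.not_feasible_transfer hg hB hnb he hle fun Y hf hY => ?_
  have hi := X.castSucc_lt_succ i
  have hj := X.castSucc_lt_succ j
  have hout : ∀ t, t ≤ X.s i.castSucc ∨ X.s j.succ ≤ t → Y.energyUsed t = X.energyUsed t := by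
    rintro t (h | h)
    · rw [hY, X.elapsed_of_le h, X.elapsed_of_le (h.trans (hi.le.trans hs.le))]
      simp
    · rw [hY, X.elapsed_div_length_eq_one h,
        X.elapsed_div_length_eq_one (hs.le.trans (hj.le.trans h))]
      simp
  refine energyFeasible_of_slack (X := X) (u := X.s i.castSucc) (v := X.s j.succ) (ε := ε)
    (fun t ht h => ?_) (fun t => ?_) (fun τ hτ h1 h2 => hslack τ hτ h2.le ⟨h1, h2⟩) ?_
  · rw [hout t h]
    exact hX.1.energy t (hf ▸ ht)
  · rw [hY]
    have h1 := X.elapsed_div_length_le_one i t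
    have h2 := X.elapsed_div_length_nonneg j t
    nlinarith
  · rw [hout _ (.inr le_rfl)]
    exact hX.1.energy.le_totalBefore
      ((X.start_nonneg.trans (X.start_le j.castSucc)).trans_lt hj)

/-- An optimal policy finishes with no energy left over: otherwise the last power could be
raised. -/
lemma IsOptimal.energyUsed_finish (hg : IsRateFunction g) (hB : 0 < B₀)
    (hX : X.IsOptimal A g B₀ Γ₀) (hnb : X.NoBreaks) (hc : X.Canonical A) {i : Fin X.N}
    (hi : X.s i.succ = X.finish) : X.energyUsed X.finish = A.totalBefore X.finish := by
  have hlt := X.castSucc_lt_succ i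
  have hpos : 0 < X.finish :=
    (X.start_nonneg.trans (X.start_le i.castSucc)).trans_lt (hlt.trans_eq hi)
  refine (hX.1.energy.le_totalBefore hpos).eq_of_not_lt fun hne => ?_
  obtain ⟨ε₁, hε₁, hslack⟩ := A.exists_slack (W := X.energyUsed)
    (P := fun τ => X.s i.castSucc < τ ∧ τ < X.s i.succ) (X.s i.succ) (fun τ hτ _ h =>
      hX.1.energy.lt_totalBefore_of_mem_interval hc hτ h)
  set ε := min ε₁ (A.totalBefore X.finish - X.energyUsed X.finish) with hεdef
  have hε : 0 < ε := lt_min hε₁ (sub_pos.2 hne)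
  have hl := X.length_pos i
  have hel : 0 < ε / X.length i := by positivity
  have hq : ∀ m, 0 < Function.update X.p i (X.p i + ε / X.length i) m := by
    intro m
    rcases eq_or_ne m i with rfl | hmi
    · rw [Function.update_self]; exact add_pos (hnb.pos m) hel
    · rw [Function.update_of_ne hmi]; exact hnb.pos m
  have hsum : ∀ (F : ℝ → ℝ) (c : Fin X.N → ℝ),
      ∑ m, F (Function.update X.p i (X.p i + ε / X.length i) m) * c m =
        ∑ m, F (X.p m) * c m + (F (X.p i + ε / X.length i) - F (X.p i)) * c i := by
    intro F c
    rw [Fintype.sum_eq_add_of_eq_off (f := fun m => F (X.p m) * c m) i]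
    · simp only [Function.update_self]; ring
    · intro m hm
      simp only [Function.update_of_ne hm]
  set Y := X.withPowers _ fun m => (hq m).le with hYdef
  have hY : ∀ t, Y.energyUsed t = X.energyUsed t + ε * (X.elapsed i t / X.length i) := by
    intro t
    rw [energyUsed_eq, energyUsed_eq, hYdef, cumulative_withPowers, hsum id, cumulative]
    simp only [id]
    ring
  have hYf : Y.finish = X.finish := rfl
  have hend : Y.energyUsed X.finish ≤ A.totalBefore X.finish := by
    rw [hY, X.elapsed_div_length_eq_one hi.le]
    linarith [min_le_right ε₁ (A.totalBefore X.finish - X.energyUsed X.finish)]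
  have hYE : Y.EnergyFeasible A := by
    refine energyFeasible_of_slack (X := X) (u := X.s i.castSucc) (v := X.finish) (ε := ε)
      (fun t ht h => ?_) (fun t => ?_) (fun τ hτ h1 h2 => ?_) hend
    · rcases h with h | h
      · rw [hY, X.elapsed_of_le h]
        simpa using hX.1.energy t ht
      · rw [le_antisymm ht.2 h]
        exact hend.trans (A.totalBefore_le_total _)
    · rw [hY]
      have := X.elapsed_div_length_le_one i t
      nlinarith
    · rw [← hi] at h2
      exact (add_le_add_right (min_le_left _ _) _).trans (hslack τ hτ h2.le ⟨h1, h2⟩)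
  have hYnb : Y.NoBreaks := fun m => (hq m).ne'
  have hon : Y.onTime ≤ Γ₀ := by
    rw [hYnb.onTime_eq]
    exact hnb.onTime_eq.symm.le.trans hX.1.onTime_le
  refine hX.not_lt_bits hB hYE hon le_rfl ?_
  have hb : Y.bits g = X.bits g + (g (X.p i + ε / X.length i) - g (X.p i)) * X.length i :=
    hsum g X.length
  have hi0 := hnb.pos i
  have := hg.strictMonoOn (mem_Ici.2 hi0.le) (mem_Ici.2 (by positivity))
    (lt_add_of_pos_right (X.p i) hel)
  rw [hb, hX.1.bits_eq]
  nlinarith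

/-- An optimal policy that does not start at once uses the whole receiver time: otherwise its first
interval could be lengthened to the left, at the same energy. -/
lemma IsOptimal.finish_sub_start (hg : IsRateFunction g) (hB : 0 < B₀)
    (hX : X.IsOptimal A g B₀ Γ₀) (hnb : X.NoBreaks) (hc : X.Canonical A) {i : Fin X.N}
    (hi : i.castSucc = 0) (hs : 0 < X.start) : X.finish - X.start = Γ₀ := by
  have hi' : X.s i.castSucc = X.start := congrArg X.s hi
  refine (hnb.onTime_eq.symm.le.trans hX.1.onTime_le).eq_of_not_lt fun hne => ?_
  have hlt := X.castSucc_lt_succ i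
  obtain ⟨ε, hε, hslack⟩ := A.exists_slack (W := X.energyUsed)
    (P := fun τ => 0 < τ ∧ τ < X.s i.succ) (X.s i.succ) (fun τ hτ _ h => by
      rcases le_or_gt τ X.start with h1 | h1
      · rw [X.energyUsed_of_le_start h1]
        exact A.totalBefore_pos h.1
      · exact hX.1.energy.lt_totalBefore_of_mem_interval hc hτ ⟨hi' ▸ h1, h.2⟩)
  have hl := X.length_pos i
  have hp := hnb.pos i
  obtain ⟨δ, hδ, hδs, hδΓ, hδε⟩ : ∃ δ > 0, δ < X.start ∧ δ ≤ Γ₀ - (X.finish - X.start) ∧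
      X.p i * δ ≤ ε := by
    refine ⟨min (X.start / 2) (min (Γ₀ - (X.finish - X.start)) (ε / X.p i)),
      lt_min (by positivity) (lt_min (by linarith) (by positivity)),
      (min_le_left _ _).trans_lt (by linarith),
      (min_le_right _ _).trans (min_le_left _ _), ?_⟩
    rw [mul_comm, ← le_div_iff₀ hp]
    exact (min_le_right _ _).trans (min_le_right _ _)
  set q := X.p i * X.length i / (X.length i + δ) with hqdef
  have hq0 : 0 < q := by positivity
  have hqp : q ≤ X.p i := by
    rw [hqdef, div_le_iff₀ (by positivity)]
    nlinarith
  have hq : ∀ m, 0 < Function.update X.p i q m := by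
    intro m
    rcases eq_or_ne m i with rfl | hmi
    · rw [Function.update_self]; exact hq0
    · rw [Function.update_of_ne hmi]; exact hnb.pos m
  set s' : Fin (X.N + 1) → ℝ := Function.update X.s 0 (X.start - δ) with hs'
  have hs'0 : s' 0 = X.start - δ := Function.update_self ..
  have hs'k : ∀ k, k ≠ 0 → s' k = X.s k := fun k hk => Function.update_of_ne hk ..
  set Y : Policy :=
    { N := X.N
      p := Function.update X.p i q
      s := s'
      p_nonneg := fun m => (hq m).le
      s_strictMono := by
        intro a b hab
        have hb : b ≠ 0 := ((Fin.zero_le a).trans_lt hab).ne'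
        rw [hs'k b hb]
        rcases eq_or_ne a 0 with rfl | ha
        · rw [hs'0]
          linarith [X.start_le b]
        · rw [hs'k a ha]
          exact X.s_strictMono hab
      start_nonneg := by rw [hs'0]; linarith } with hYdef
  have hsucc : ∀ m : Fin X.N, s' m.succ = X.s m.succ := fun m => hs'k _ (Fin.succ_ne_zero m)
  have hcast : ∀ m : Fin X.N, m ≠ i → s' m.castSucc = X.s m.castSucc := fun m hm =>
    hs'k _ fun h => hm (Fin.castSucc_injective _ (h.trans hi.symm))
  have hcasti : s' i.castSucc = X.start - δ := by rw [hi, hs'0]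
  have hsum : ∀ (F : ℝ → ℝ) (t : ℝ), Y.cumulative F t = X.cumulative F t +
      (F q * max 0 (min t (X.s i.succ) - (X.start - δ)) - F (X.p i) * X.elapsed i t) := by
    intro F t
    refine (Fintype.sum_eq_add_of_eq_off (f := fun m => F (X.p m) * X.elapsed m t) i ?_).trans ?_
    · intro m hm
      change F (Function.update X.p i q m) * max 0 (min t (s' m.succ) - s' m.castSucc) = _
      rw [Function.update_of_ne hm, hsucc, hcast m hm, elapsed]
    · change _ + (F (Function.update X.p i q i) * max 0 (min t (s' i.succ) - s' i.castSucc) - _) = _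
      rw [Function.update_self, hsucc, hcasti, cumulative]
  have hN : Fin.last X.N ≠ 0 := by
    rw [← hi]; exact (Fin.castSucc_lt_last i).ne'
  have hYf : Y.finish = X.finish := hs'k _ hN
  have hYs : Y.start = X.start - δ := hs'0
  have hlen : X.length i = X.s i.succ - X.start := by rw [length, hi']
  have hafter : ∀ (F : ℝ → ℝ) (t : ℝ), X.s i.succ ≤ t → Y.cumulative F t = X.cumulative F t +
      ((X.length i + δ) * F q - X.length i * F (X.p i)) := by
    intro F t ht
    rw [hsum, X.elapsed_of_ge ht, min_eq_right ht, max_eq_right (by linarith), hi', hlen]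
    ring
  have hUafter : ∀ t, X.s i.succ ≤ t → Y.energyUsed t = X.energyUsed t := by
    intro t ht
    rw [energyUsed_eq, hafter id t ht, energyUsed_eq, hqdef]
    simp only [id]
    field_simp
    ring
  have hYE : Y.EnergyFeasible A := by
    refine energyFeasible_of_slack (X := X) (u := X.start - δ) (v := X.s i.succ) (ε := ε)
      (fun t ht h => ?_) (fun t => ?_)
      (fun τ hτ h1 h2 => hslack τ hτ h2.le ⟨by linarith, h2⟩) ?_
    · rcases h with h | h
      · rw [Y.energyUsed_of_le_start (h.trans hYs.ge)]
        exact (A.total_pos ht.1).le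
      · rw [hUafter t h]
        exact hX.1.energy t (hYf ▸ ht)
    · rw [energyUsed_eq, hsum id t, ← energyUsed_eq, elapsed, hi']
      simp only [id]
      have h1 : max 0 (min t (X.s i.succ) - (X.start - δ)) ≤
          max 0 (min t (X.s i.succ) - X.start) + δ :=
        max_le (by positivity) (by linarith [le_max_right 0 (min t (X.s i.succ) - X.start)])
      have h2 := mul_le_mul_of_nonneg_left h1 hq0.le
      have h3 := mul_le_mul_of_nonneg_right hqp
        (show 0 ≤ max 0 (min t (X.s i.succ) - X.start) + δ by positivity)
      linarith
    · rw [hUafter _ le_rfl]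
      exact hX.1.energy.le_totalBefore (by linarith)
  have hYnb : Y.NoBreaks := fun m => (hq m).ne'
  have hon : Y.onTime ≤ Γ₀ := by
    rw [hYnb.onTime_eq, hYf, hYs]
    linarith
  refine hX.not_lt_bits hB hYE hon hYf.le ?_
  rw [Y.bits_eq g le_rfl, hYf, hafter g _ (X.le_finish _), ← X.bits_eq g le_rfl, hX.1.bits_eq]
  have := hg.perspective_lt (show 0 < X.p i * X.length i by positivity) hl
    (show X.length i < X.length i + δ by linarith)
  rw [← hqdef, mul_div_cancel_right₀ _ hl.ne'] at this
  linarith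

end Improvement

end Policy

/-! ### The Lagrangian bound -/

namespace Policy

variable {X Y : Policy} {A : EnergyArrivals} {g : ℝ → ℝ} {B₀ Γ₀ : ℝ}

/-- The part of the window `[t, X.finish]` that the receiver time left to `Y` after `t` cannot
fill. It is positive for `t < X.finish` if `Y` finishes before `X`. -/
def spare (X Y : Policy) (t : ℝ) : ℝ := X.finish - t - (Y.onTime - Y.onTimeBy t)

lemma spare_pos (hYX : Y.finish < X.finish) {t : ℝ} (ht : t < X.finish) : 0 < spare X Y t := by
  have h := Y.onTimeBy_sub_le ht.le
  rw [min_eq_right hYX.le, ← Y.onTime_eq hYX.le] at h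
  rw [spare]
  rcases le_total t Y.finish with h1 | h1
  · rw [min_eq_left h1] at h; linarith
  · rw [min_eq_right h1] at h; linarith

lemma spare_finish (hYX : Y.finish < X.finish) : spare X Y X.finish = 0 := by
  rw [spare, ← Y.onTime_eq hYX.le]; ring

/-- The tangent of `g` at the power of `X` on each interval prices energy and receiver time: the
price of energy decreases and that of receiver time increases along the policy. At these prices
`Y` gains nothing from energy, as `X` has used at least as much by each listed instant, and loses
in receiver time, as `Y` must stop earlier. -/
lemma bits_sub_bits_le (hg : IsRateFunction g) (hnb : X.NoBreaks) (hmono : Monotone X.p)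
    (hU : ∀ k, k ≠ 0 → Y.energyUsed (X.s k) ≤ X.energyUsed (X.s k)) (hYX : Y.finish < X.finish)
    {i₀ i₁ : Fin X.N} (hi₀ : i₀.castSucc = 0) (hi₁ : X.s i₁.succ = X.finish) :
    ∃ δ > 0, Y.bits g - X.bits g ≤
      tangentOffset g (X.p i₀) * (Y.onTime - (X.finish - X.start)) -
        (tangentOffset g (X.p i₁) - tangentOffset g (X.p i₀)) * δ := by
  have : Nonempty (Fin X.N) := ⟨i₀⟩
  obtain ⟨m, hm⟩ := Finite.exists_min fun i : Fin X.N => spare X Y (X.s i.castSucc)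
  refine ⟨spare X Y (X.s m.castSucc),
    spare_pos hYX ((X.castSucc_lt_succ m).trans_le (X.le_finish _)), ?_⟩
  set δ := spare X Y (X.s m.castSucc)
  set K := tangentOffset g (X.p i₀) * (Y.onTime - (X.finish - X.start))
  -- The bound at the start of an interval passes to its end at the same prices.
  have step : ∀ i : Fin X.N,
      Y.cumulative g (X.s i.castSucc) - X.cumulative g (X.s i.castSucc) ≤
        tangentSlope g (X.p i) * (Y.energyUsed (X.s i.castSucc) - X.energyUsed (X.s i.castSucc)) +
        tangentOffset g (X.p i) * spare X Y (X.s i.castSucc) + K -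
        (tangentOffset g (X.p i) - tangentOffset g (X.p i₀)) * δ →
      Y.cumulative g (X.s i.succ) - X.cumulative g (X.s i.succ) ≤
        tangentSlope g (X.p i) * (Y.energyUsed (X.s i.succ) - X.energyUsed (X.s i.succ)) +
        tangentOffset g (X.p i) * spare X Y (X.s i.succ) + K -
        (tangentOffset g (X.p i) - tangentOffset g (X.p i₀)) * δ := by
    intro i h
    have hlt := X.castSucc_lt_succ i
    have h1 := Y.cumulative_sub_le hlt.le fun q hq => hg.le_tangent (hnb.pos i) hq
    have e1 := X.cumulative_of_mem g (right_mem_Icc.2 hlt.le)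
    have e2 := X.cumulative_of_mem id (right_mem_Icc.2 hlt.le)
    rw [← energyUsed_eq, ← energyUsed_eq, id] at e2
    rw [IsRateFunction.eq_tangent g (X.p i)] at e1
    rw [e1, e2]
    simp only [spare] at h ⊢
    linarith
  have base : ∀ n (hn : n < X.N),
      Y.cumulative g (X.s (Fin.castSucc ⟨n, hn⟩)) - X.cumulative g (X.s (Fin.castSucc ⟨n, hn⟩)) ≤
        tangentSlope g (X.p ⟨n, hn⟩) * (Y.energyUsed (X.s (Fin.castSucc ⟨n, hn⟩)) -
          X.energyUsed (X.s (Fin.castSucc ⟨n, hn⟩))) +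
        tangentOffset g (X.p ⟨n, hn⟩) * spare X Y (X.s (Fin.castSucc ⟨n, hn⟩)) + K -
        (tangentOffset g (X.p ⟨n, hn⟩) - tangentOffset g (X.p i₀)) * δ := by
    intro n
    induction n with
    | zero =>
      intro hn
      have h0 : (⟨0, hn⟩ : Fin X.N) = i₀ := by
        ext
        simpa using (congrArg Fin.val hi₀).symm
      have hs : X.s i₀.castSucc = X.start := congrArg X.s hi₀
      -- Before the start of `X`, the prices of its first interval are charged.
      have h1 := Y.cumulative_sub_le (min_le_left X.start Y.start)
        fun q hq => hg.le_tangent (hnb.pos i₀) hq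
      rw [Y.cumulative_of_le_start g (min_le_right _ _),
        Y.energyUsed_of_le_start (min_le_right _ _), onTimeBy, onTimeBy,
        Y.cumulative_of_le_start _ (min_le_right _ _), ← onTimeBy] at h1
      rw [h0, hs, X.cumulative_of_le_start g le_rfl, X.energyUsed_of_le_start le_rfl, spare]
      simp only [K]
      linarith
    | succ n ih =>
      intro hn
      have hn' : n < X.N := Nat.lt_of_succ_lt hn
      have h := step ⟨n, hn'⟩ (ih hn')
      have hk : (⟨n, hn'⟩ : Fin X.N).succ = Fin.castSucc ⟨n + 1, hn⟩ := rfl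
      rw [hk] at h
      have hp : X.p ⟨n, hn'⟩ ≤ X.p ⟨n + 1, hn⟩ := hmono (Fin.le_def.2 (Nat.le_succ n))
      have h1 := hg.tangentSlope_le (hnb.pos _) hp
      have h2 := hg.tangentOffset_le (hnb.pos _) hp
      have h3 := hU (Fin.castSucc ⟨n + 1, hn⟩) (by rw [← hk]; exact Fin.succ_ne_zero _)
      have h4 := hm ⟨n + 1, hn⟩
      have h5 := mul_le_mul_of_nonneg_left h4 (sub_nonneg.2 h2)
      have h6 := mul_le_mul_of_nonpos_right h1 (sub_nonpos.2 h3)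
      linarith
  have hfin := step i₁ (base i₁ i₁.isLt)
  have h3 := hU i₁.succ (Fin.succ_ne_zero _)
  rw [hi₁] at hfin h3
  rw [spare_finish hYX, ← X.bits_eq g le_rfl, ← Y.bits_eq g hYX.le] at hfin
  have h4 := mul_nonpos_of_nonneg_of_nonpos (hg.tangentSlope_pos (hnb.pos i₁)).le
    (sub_nonpos.2 h3)
  linarith

/-- If `X` uses a constant power `p`, a competitor `Y` that sends as much data within the same
receiver time and energy must also use `p` whenever it is on, for exactly as long as `X`. An instant
inside, by which it has used at most as much energy as `X`, then bounds its receiver time on either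
side. -/
lemma bits_ne_of_constant (hg : IsRateFunction g) (hnb : X.NoBreaks) {p : ℝ} (hp : 0 < p)
    (hconst : ∀ i, X.p i = p) (hU : ∀ k, k ≠ 0 → Y.energyUsed (X.s k) ≤ X.energyUsed (X.s k))
    (hYX : Y.finish < X.finish) (hon : Y.onTime ≤ X.onTime) {j : Fin (X.N + 1)} (hj : j ≠ 0)
    (hj' : j ≠ Fin.last X.N) : Y.bits g ≠ X.bits g := by
  intro hb
  have hXon := hnb.onTime_eq
  have hXF : ∀ (F : ℝ → ℝ) k, X.cumulative F (X.s k) = F p * (X.s k - X.start) := by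
    intro F k
    have := X.sum_elapsed (X.s k)
    rw [min_eq_left (X.le_finish k), min_eq_right (X.start_le k)] at this
    simp only [cumulative, hconst, ← Finset.mul_sum, this]
  have hXb : X.bits g = g p * (X.finish - X.start) := by
    rw [X.bits_eq g le_rfl]; exact hXF g (Fin.last _)
  have hXU : ∀ k, X.energyUsed (X.s k) = p * (X.s k - X.start) := fun k => hXF id k
  have hlast : Fin.last X.N ≠ 0 := fun h => hj (Fin.le_zero_iff.1 (h ▸ Fin.le_last j))
  have hUe : Y.energyUsed X.finish ≤ p * (X.finish - X.start) :=
    (hU _ hlast).trans_eq (hXU (Fin.last _))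
  have hl := hg.tangentSlope_pos hp
  have hh := hg.tangentOffset_pos hp
  -- The total loss against the tangent bound is a sum of nonnegative losses, and vanishes.
  have hterm : ∀ i : Fin Y.N, 0 ≤ (tangentSlope g p * Y.p i +
      tangentOffset g p * (if Y.p i ≠ 0 then 1 else 0) - g (Y.p i)) * Y.elapsed i X.finish :=
    fun i => mul_nonneg (sub_nonneg.2 (hg.le_tangent hp (Y.p_nonneg i))) (Y.elapsed_nonneg i _)
  have hsum : ∑ i : Fin Y.N, (tangentSlope g p * Y.p i +
      tangentOffset g p * (if Y.p i ≠ 0 then 1 else 0) - g (Y.p i)) * Y.elapsed i X.finish =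
      tangentSlope g p * Y.energyUsed X.finish + tangentOffset g p * Y.onTime - Y.bits g := by
    rw [Y.onTime_eq hYX.le, Y.bits_eq g hYX.le, energyUsed_eq, onTimeBy, cumulative, cumulative,
      cumulative, Finset.mul_sum, Finset.mul_sum, ← Finset.sum_add_distrib,
      ← Finset.sum_sub_distrib]
    exact Finset.sum_congr rfl fun i _ => by simp only [id]; ring
  have hge : 0 ≤ tangentSlope g p * Y.energyUsed X.finish + tangentOffset g p * Y.onTime -
      Y.bits g := hsum ▸ Finset.sum_nonneg fun i _ => hterm i
  have h1 := mul_le_mul_of_nonneg_left hUe hl.le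
  have h2 := mul_le_mul_of_nonneg_left hon hh.le
  rw [hXon] at h2
  rw [IsRateFunction.eq_tangent g p] at hXb
  have honeq : X.finish - X.start ≤ Y.onTime := by
    have : tangentOffset g p * (X.finish - X.start) ≤ tangentOffset g p * Y.onTime := by linarith
    exact le_of_mul_le_mul_left this hh
  have hzero : ∀ i : Fin Y.N, Y.p i = 0 ∨ Y.p i = p := by
    have hz := (Finset.sum_eq_zero_iff_of_nonneg fun i _ => hterm i).1
      (le_antisymm (hsum.trans_le (by linarith)) (Finset.sum_nonneg fun i _ => hterm i))
    intro i
    by_contra! hne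
    have hlt := hg.lt_tangent hp (Y.p_nonneg i) hne.2
    have := hz i (Finset.mem_univ i)
    rw [if_pos hne.1, Y.elapsed_of_ge ((Y.le_finish _).trans hYX.le), mul_one] at this
    exact (mul_pos (sub_pos.2 hlt) (sub_pos.2 (Y.castSucc_lt_succ i))).ne' this
  have hYU : Y.energyUsed (X.s j) = p * Y.onTimeBy (X.s j) := by
    rw [energyUsed_eq, onTimeBy, cumulative, cumulative, Finset.mul_sum]
    refine Finset.sum_congr rfl fun i _ => ?_
    rcases hzero i with h | h
    · simp [h]
    · simp [h, hp.ne']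
  have h3 := hU j hj
  rw [hYU, hXU] at h3
  have h4 := le_of_mul_le_mul_left h3 hp
  have h5 := spare_pos hYX (X.s_strictMono (Fin.lt_last_iff_ne_last.2 hj') : X.s j < X.finish)
  rw [spare] at h5
  linarith

/-- Sufficiency: no feasible policy finishes before a policy with nondecreasing powers that uses all
available energy by each listed instant and starts at `0` or uses the whole receiver time, where
in the latter case it must have such an instant inside. -/
lemma Feasible.finish_le (hg : IsRateFunction g) (hB : 0 < B₀) (hnb : X.NoBreaks)
    (hXb : X.bits g = B₀) (hmono : Monotone X.p)
    (hexh : ∀ k, k ≠ 0 → X.energyUsed (X.s k) = A.totalBefore (X.s k))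
    (hwin : 0 < X.start → X.finish - X.start = Γ₀)
    (hint : 0 < X.start → ∃ j, j ≠ 0 ∧ j ≠ Fin.last X.N) (hY : Y.Feasible A g B₀ Γ₀) :
    X.finish ≤ Y.finish := by
  by_contra! hYX
  have hN : 0 < X.N := X.N_pos_of_bits_ne_zero (hXb ▸ hB.ne')
  set i₀ : Fin X.N := ⟨0, hN⟩
  set i₁ : Fin X.N := ⟨X.N - 1, Nat.sub_lt hN one_pos⟩ with hi₁
  have hlast : i₁.succ = Fin.last X.N := Fin.ext (by simp [hi₁]; omega)
  have hU : ∀ k, k ≠ 0 → Y.energyUsed (X.s k) ≤ X.energyUsed (X.s k) := by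
    intro k hk
    rw [hexh k hk]
    exact hY.energy.le_totalBefore
      (X.start_nonneg.trans_lt (X.s_strictMono (Fin.pos_iff_ne_zero.2 hk)))
  obtain ⟨δ, hδ, hle⟩ := bits_sub_bits_le hg hnb hmono hU hYX (i₀ := i₀) (i₁ := i₁) rfl
    (congrArg X.s hlast)
  rw [hXb, hY.bits_eq, sub_self] at hle
  have hp₀ := hnb.pos i₀
  have hoff := hg.tangentOffset_pos hp₀
  have hp : X.p i₀ ≤ X.p i₁ := hmono (Fin.le_def.2 (Nat.zero_le _))
  rcases X.start_eq_or_pos with hs | hs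
  · have h1 : Y.onTime - (X.finish - X.start) < 0 := by linarith [Y.onTime_le_finish]
    have h2 := mul_neg_of_pos_of_neg hoff h1
    have h3 := mul_nonneg (sub_nonneg.2 (hg.tangentOffset_le hp₀ hp)) hδ.le
    linarith
  · have hon : Y.onTime - (X.finish - X.start) ≤ 0 := by linarith [hwin hs, hY.onTime_le]
    have h2 := mul_nonpos_of_nonneg_of_nonpos hoff.le hon
    rcases hp.eq_or_lt with hp | hp
    · obtain ⟨j, hj, hj'⟩ := hint hs
      refine bits_ne_of_constant hg hnb hp₀ (fun i => ?_) hU hYX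
        (by rw [hnb.onTime_eq]; linarith) hj hj' (hY.bits_eq.trans hXb.symm)
      refine le_antisymm (hp ▸ hmono (Fin.le_def.2 ?_)) (hmono (Fin.le_def.2 (Nat.zero_le _)))
      exact Nat.le_sub_one_of_lt i.isLt
    · have h3 := mul_pos (sub_pos.2 (hg.tangentOffset_lt hp₀ hp)) hδ
      linarith

/-! ### The initial constant-power policy -/

/-- The policy with constant power `p` on `[a, a + d]`. -/
def const (a p d : ℝ) (ha : 0 ≤ a) (hp : 0 ≤ p) (hd : 0 < d) : Policy where
  N := 1
  p _ := p
  s := ![a, a + d]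
  p_nonneg _ := hp
  s_strictMono := by
    rw [Fin.strictMono_iff_lt_succ]
    intro i
    rw [Subsingleton.elim i 0]
    simpa using hd
  start_nonneg := ha

lemma energyUsed_const {a p d : ℝ} (ha : 0 ≤ a) (hp : 0 ≤ p) (hd : 0 < d) (t : ℝ) :
    (const a p d ha hp hd).energyUsed t = p * max 0 (min t (a + d) - a) :=
  Fin.sum_univ_one _

lemma const_energyFeasible {a p d : ℝ} (ha : 0 ≤ a) (hp : 0 ≤ p) (hd : 0 < d)
    (h : A.ConstFeasible p d a) : (const a p d ha hp hd).EnergyFeasible A := by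
  intro t ht
  have ht2 : t ≤ a + d := ht.2
  rw [energyUsed_const, min_eq_left ht2]
  rcases le_total t a with h1 | h1
  · rw [max_eq_left (sub_nonpos.2 h1), mul_zero]
    exact (A.total_pos ht.1).le
  · rw [max_eq_right (sub_nonneg.2 h1)]
    exact h.2 t ⟨h1, ht2⟩

/-- The energy that has arrived before the end of a feasible policy would suffice at constant
power over the whole receiver time. -/
lemma Feasible.exists_epoch (hg : IsRateFunction g) (hB : 0 < B₀) (hΓ : 0 < Γ₀)
    (hX : X.Feasible A g B₀ Γ₀) : ∃ τ ∈ A.epochs, τ < X.finish ∧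
      B₀ ≤ Γ₀ * g (A.total τ / Γ₀) := by
  have hpos : 0 < X.finish := by
    by_contra! h
    have := X.bits_eq g le_rfl
    rw [hX.bits_eq, X.cumulative_of_le_start g (h.trans X.start_nonneg)] at this
    exact hB.ne' this
  obtain ⟨τ, hτ, hτ0, hτf, he⟩ := A.exists_total_eq_totalBefore hpos
  have hτe := he τ le_rfl hτf
  refine ⟨τ, hτ, hτf, ?_⟩
  have hU := hX.energy.le_totalBefore hpos
  have hC : 0 < A.total τ := A.total_pos hτ0
  rw [← hτe] at hU
  have hq : 0 < A.total τ / Γ₀ := by positivity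
  have h := X.cumulative_sub_le X.finish_nonneg fun q hq' => hg.le_tangent hq hq'
  rw [X.cumulative_of_le_start g X.start_nonneg, X.energyUsed_of_le_start X.start_nonneg, onTimeBy,
    onTimeBy, X.cumulative_of_le_start _ X.start_nonneg, ← onTimeBy, ← X.onTime_eq le_rfl,
    ← X.bits_eq g le_rfl, hX.bits_eq] at h
  have h1 := mul_le_mul_of_nonneg_left hU (hg.tangentSlope_pos hq).le
  have h2 := mul_le_mul_of_nonneg_left hX.onTime_le (hg.tangentOffset_pos hq).le
  rw [IsRateFunction.eq_tangent g (A.total τ / Γ₀)]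
  have h3 : Γ₀ * (tangentSlope g (A.total τ / Γ₀) * (A.total τ / Γ₀) +
      tangentOffset g (A.total τ / Γ₀)) = tangentSlope g (A.total τ / Γ₀) * A.total τ +
      tangentOffset g (A.total τ / Γ₀) * Γ₀ := by field_simp
  rw [h3]
  linarith

end Policy

namespace EnergyArrivals

variable {A : EnergyArrivals} {g : ℝ → ℝ} {B₀ Γ₀ : ℝ}

lemma ConstFeasible.le_totalBefore {p d a t : ℝ} (h : A.ConstFeasible p d a) (hp : 0 ≤ p)
    (hd : 0 < d) (ht : 0 < t) (hta : t ≤ a + d) : p * max 0 (t - a) ≤ A.totalBefore t := by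
  have := (Policy.const_energyFeasible h.1 hp hd h).le_totalBefore ht
  rwa [Policy.energyUsed_const, min_eq_left hta] at this

/-- The earliest start exists: the feasible starts form a nonempty set, and it contains its infimum
as the harvested energy is right-continuous. -/
lemma exists_isLeast_start {τn p d : ℝ} (hτn : τn ∈ A.epochs) (hp : 0 ≤ p)
    (hpd : p * d = A.total τn) : ∃ a, IsLeast {x | A.ConstFeasible p d x} a := by
  set S := {x | A.ConstFeasible p d x} with hS
  have hne : S.Nonempty := by
    refine ⟨τn, A.nonneg τn hτn, fun t ht => ?_⟩
    have : p * (t - τn) ≤ p * d := mul_le_mul_of_nonneg_left (by linarith [ht.2]) hp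
    exact this.trans (hpd.le.trans (A.total_mono ht.1))
  have hbdd : BddBelow S := ⟨0, fun x hx => hx.1⟩
  refine ⟨sInf S, ⟨le_csInf hne fun x hx => hx.1, fun t ht => ?_⟩, fun x hx => csInf_le hbdd hx⟩
  obtain ⟨c, htc, -, -, hc⟩ := A.exists_totalBefore_eq_total (lt_add_one t)
  obtain ⟨x, hx, hxlt⟩ := exists_lt_of_csInf_lt hne
    (show sInf S < sInf S + (c - t) by linarith)
  have hax : sInf S ≤ x := csInf_le hbdd hx
  have h := hx.2 (t + (x - sInf S)) ⟨by linarith [ht.1], by linarith [ht.2]⟩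
  rw [show t + (x - sInf S) - x = t - sInf S by ring] at h
  exact h.trans ((A.total_le_totalBefore (by linarith)).trans_eq hc)

/-- If the earliest start is positive, the constant-power policy exhausts the energy at an epoch
not after `τn`: otherwise it could start earlier, since after `τn` it never lacks energy. -/
lemma exists_exhausted_epoch {τn p d a : ℝ} (hτn : τn ∈ A.epochs) (hd : 0 < d)
    (hpd : p * d = A.total τn) (ha : IsLeast {x | A.ConstFeasible p d x} a) (ha0 : 0 < a) :
    ∃ τ ∈ A.epochs, a < τ ∧ τ ≤ τn ∧ τ ≤ a + d ∧ p * (τ - a) = A.totalBefore τ := by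
  have hp : 0 < p := by
    have : 0 < p * d := hpd ▸ A.total_pos (A.nonneg τn hτn)
    exact pos_of_mul_pos_left this hd.le
  have hn : τn ≤ a + d := by
    by_contra! hlt
    have h1 := ha.1.2 (a + d) ⟨by linarith, le_rfl⟩
    rw [add_sub_cancel_left, hpd, A.total_eq_totalBefore_add hτn] at h1
    linarith [A.total_le_totalBefore hlt, A.pos τn hτn]
  by_contra! hno
  obtain ⟨ε, hε, hslack⟩ := A.exists_slack (W := fun τ => p * (τ - a)) (P := fun τ => 0 < τ) τn (by
    intro τ hτ hτn' hτ0
    rcases le_or_gt τ a with h | h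
    · exact (mul_nonpos_of_nonneg_of_nonpos hp.le (sub_nonpos.2 h)).trans_lt (A.totalBefore_pos hτ0)
    · have h1 := ha.1.le_totalBefore hp.le hd hτ0 (hτn'.trans hn)
      rw [max_eq_right (sub_pos.2 h).le] at h1
      exact h1.lt_of_ne (hno τ hτ h hτn' (hτn'.trans hn)))
  set η := min a (ε / p) with hη
  have hη0 : 0 < η := lt_min ha0 (by positivity)
  have hηp : p * η ≤ ε := by
    rw [mul_comm, ← le_div_iff₀ hp]; exact min_le_right _ _
  have hηa : η ≤ a := min_le_left _ _
  have hfeas : A.ConstFeasible p d (a - η) := by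
    refine ⟨by linarith, fun t ht => ?_⟩
    rcases le_or_gt τn t with h | h
    · have : p * (t - (a - η)) ≤ p * d := mul_le_mul_of_nonneg_left (by linarith [ht.2]) hp.le
      exact this.trans (hpd.le.trans (A.total_mono h))
    · have key : ∀ τ ∈ A.epochs, t < τ → τ ≤ τn → p * (t - (a - η)) ≤ A.totalBefore τ := by
        intro τ hτ h1 h2
        have h3 := hslack τ hτ h2 (by linarith [ht.1])
        nlinarith
      exact A.le_total_of_forall_epoch h (fun τ hτ h1 h2 => key τ hτ h1 h2.le)
        (key τn hτn h le_rfl)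
  linarith [ha.2 hfeas]

/-- All data of `IsInitEpoch`, with `d ≤ Γ₀`. -/
lemma exists_initEpoch (hg : IsRateFunction g) (hB : 0 < B₀) (hΓ : 0 < Γ₀) {τ : ℝ}
    (hτ : τ ∈ A.epochs) (hτB : B₀ ≤ Γ₀ * g (A.total τ / Γ₀)) :
    ∃ τn d p a τq : ℝ,
      IsLeast {τ | τ ∈ A.epochs ∧ B₀ ≤ Γ₀ * g (A.total τ / Γ₀)} τn ∧
      0 < d ∧ d ≤ Γ₀ ∧ d * g (A.total τn / d) = B₀ ∧ p = A.total τn / d ∧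
      IsLeast {x | A.ConstFeasible p d x} a ∧
      IsLeast {τ | τ ∈ A.epochs ∧ τ ∈ Icc a (a + d) ∧ p * (τ - a) = A.totalBefore τ} τq := by
  obtain ⟨τn, hn⟩ := A.exists_isLeast
    (S := {τ | τ ∈ A.epochs ∧ B₀ ≤ Γ₀ * g (A.total τ / Γ₀)}) (fun _ h => h.1) ⟨τ, hτ, hτB⟩
  have hC : 0 < A.total τn := A.total_pos (A.nonneg τn hn.1.1)
  obtain ⟨d, hd, hdΓ, hde⟩ := hg.exists_perspective_eq hC hB hΓ hn.1.2
  have hpd : A.total τn / d * d = A.total τn := by field_simp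
  obtain ⟨a, ha⟩ := exists_isLeast_start hn.1.1 (by positivity) hpd
  suffices hne : {τ | τ ∈ A.epochs ∧ τ ∈ Icc a (a + d) ∧
      A.total τn / d * (τ - a) = A.totalBefore τ}.Nonempty by
    obtain ⟨τq, hq⟩ := A.exists_isLeast (fun _ h => h.1) hne
    exact ⟨τn, d, _, a, τq, hn, hd, hdΓ, hde, rfl, ha, hq⟩
  rcases ha.1.1.eq_or_lt with h0 | h0
  · refine ⟨0, A.zero_mem, ⟨h0.ge, by linarith⟩, ?_⟩
    rw [← h0, sub_self, mul_zero, A.totalBefore_zero]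
  · obtain ⟨τ, h1, h2, h3, h4, h5⟩ := exists_exhausted_epoch hn.1.1 hd hpd ha h0
    exact ⟨τ, h1, ⟨h2.le, h4⟩, h5⟩

end EnergyArrivals

namespace Policy

variable {X Y : Policy} {A : EnergyArrivals} {g : ℝ → ℝ} {B₀ Γ₀ : ℝ}

/-- A policy with the touching properties that starts not later than `a` and finishes not later than
`a + d` runs above the constant-power policy on `[a, a + d]`. -/
lemma le_energyUsed_of_constFeasible {p d a : ℝ} (hp : 0 ≤ p) (hd : 0 < d)
    (h : A.ConstFeasible p d a)
    (hexh : ∀ k, k ≠ 0 → X.energyUsed (X.s k) = A.totalBefore (X.s k))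
    (hs : X.start ≤ a) (hf : X.finish ≤ a + d) {t : ℝ} (ht : t ∈ Icc X.start X.finish) :
    p * max 0 (t - a) ≤ X.energyUsed t := by
  refine le_energyUsed_of_le_grid (W := fun t => p * max 0 (t - a)) (fun t _ => ?_)
    (fun k => ?_) ht
  · rcases le_total t a with h1 | h1
    · refine ⟨0, fun x _ => ?_⟩
      simp only [max_eq_left (sub_nonpos.2 h1), mul_zero, zero_mul, add_zero]
      positivity
    · refine ⟨p, fun x _ => ?_⟩
      simp only [max_eq_right (sub_nonneg.2 h1)]
      nlinarith [le_max_right 0 (x - a)]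
  · rcases eq_or_ne k 0 with rfl | hk
    · simp only [max_eq_left (sub_nonpos.2 (show X.s 0 ≤ a from hs)), mul_zero]
      exact X.energyUsed_nonneg _
    · rw [hexh k hk]
      exact h.le_totalBefore hp hd
        (X.start_nonneg.trans_lt (X.s_strictMono (Fin.pos_iff_ne_zero.2 hk)))
        ((X.le_finish k).trans hf)

/-- An optimal policy with the touching properties passes through the initial epoch, with all
energy used up there. -/
lemma IsOptimal.exists_initEpoch (hg : IsRateFunction g) (hB : 0 < B₀) (hΓ : 0 < Γ₀)
    (hX : X.IsOptimal A g B₀ Γ₀) (hc : X.Canonical A)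
    (hexh : ∀ k, k ≠ 0 → X.energyUsed (X.s k) = A.totalBefore (X.s k))
    (hwin : 0 < X.start → X.finish - X.start = Γ₀) :
    ∃ τq, A.IsInitEpoch g B₀ Γ₀ τq ∧ ∃ j, X.s j = τq ∧ X.energyUsed τq = A.totalBefore τq := by
  obtain ⟨τ, hτ, hτf, hτB⟩ := hX.1.exists_epoch hg hB hΓ
  obtain ⟨τn, d, p, a, τq, hn, hd, hdΓ, hde, hpe, ha, hq⟩ :=
    EnergyArrivals.exists_initEpoch hg hB hΓ hτ hτB
  refine ⟨τq, ⟨τn, d, p, a, hn, hd, hde, hpe, ha, hq⟩, ?_⟩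
  have hC : 0 < A.total τn := A.total_pos (A.nonneg τn hn.1.1)
  have hp : 0 < p := by rw [hpe]; positivity
  have hpd : p * d = A.total τn := by rw [hpe]; field_simp
  have hf : X.finish ≤ a + d := by
    refine hX.2 (const a p d ha.1.1 hp.le hd)
      ⟨?_, const_energyFeasible ha.1.1 hp.le hd ha.1, ?_⟩
    · refine (Fin.sum_univ_one _).trans ?_
      change g p * (a + d - a) = B₀
      rw [add_sub_cancel_left, mul_comm, hpe, hde]
    · rw [NoBreaks.onTime_eq fun _ => hp.ne']
      change a + d - a ≤ Γ₀
      linarith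
  rcases ha.1.1.eq_or_lt with h0 | h0
  · -- The constant-power policy starts at `0`, and so does `X`.
    have hs : X.start = 0 := by
      refine (X.start_eq_or_pos.resolve_right fun hs => ?_).symm
      linarith [hwin hs]
    have hq0 : τq = 0 := by
      refine le_antisymm (hq.2 ⟨A.zero_mem, ⟨h0.ge, by linarith⟩, ?_⟩) (A.nonneg _ hq.1.1)
      rw [← h0, sub_self, mul_zero, A.totalBefore_zero]
    refine ⟨0, hs.trans hq0.symm, ?_⟩
    rw [hq0, A.totalBefore_zero, X.energyUsed_of_le_start X.start_nonneg]
  · obtain ⟨σ, h1, h2, h3, h4, h5⟩ := EnergyArrivals.exists_exhausted_epoch hn.1.1 hd hpd ha h0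
    have hqn : τq ≤ τn := (hq.2 ⟨h1, ⟨h2.le, h4⟩, h5⟩).trans h3
    have hqf : τq < X.finish := hqn.trans_lt ((hn.2 ⟨hτ, hτB⟩).trans_lt hτf)
    have haq : a < τq := by
      refine hq.1.2.1.1.lt_of_ne fun h => ?_
      have := hq.1.2.2
      rw [← h, sub_self, mul_zero] at this
      exact (A.totalBefore_pos h0).ne this
    have hs : X.start ≤ a := by
      rcases X.start_eq_or_pos with hs | hs
      · linarith
      · linarith [hwin hs]
    have hle := le_energyUsed_of_constFeasible hp.le hd ha.1 hexh hs hf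
      (t := τq) ⟨hs.trans haq.le, hqf.le⟩
    rw [max_eq_right (sub_pos.2 haq).le, hq.1.2.2] at hle
    have hU : X.energyUsed τq = A.totalBefore τq :=
      le_antisymm (hX.1.energy.le_totalBefore (h0.trans haq)) hle
    obtain ⟨k, hk⟩ := hc.mem_of_exhausts τq ⟨hs.trans_lt haq, hqf⟩ ⟨hq.1.1, hU⟩
    exact ⟨k, hk, hU⟩

/-- A policy that uses up all energy at the initial epoch does so strictly inside its span, unless
it starts at `0`. -/
lemma exists_interior_of_isInitEpoch (hg : IsRateFunction g) (hB : 0 < B₀) (hΓ : 0 < Γ₀)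
    (hX : X.Feasible A g B₀ Γ₀) (hs : 0 < X.start) {τq : ℝ} (hq : A.IsInitEpoch g B₀ Γ₀ τq)
    {j : Fin (X.N + 1)} (hj : X.s j = τq) (hU : X.energyUsed τq = A.totalBefore τq) :
    j ≠ 0 ∧ j ≠ Fin.last X.N := by
  have hq0 : 0 < τq := hj ▸ hs.trans_le (X.start_le j)
  refine ⟨?_, ?_⟩
  · rintro rfl
    rw [X.energyUsed_of_le_start hj.ge] at hU
    exact (A.totalBefore_pos hq0).ne hU
  · rintro rfl
    obtain ⟨τn, d, p, a, hn, hd, hde, hpe, ha, hq⟩ := hq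
    have hpd : p * d = A.total τn := by rw [hpe]; field_simp
    have ha0 : 0 < a := by
      refine ha.1.1.lt_of_ne fun h0 => ?_
      have : τq ≤ 0 := hq.2 ⟨A.zero_mem, ⟨h0.ge, by linarith⟩, by
        rw [← h0, sub_self, mul_zero, A.totalBefore_zero]⟩
      linarith
    obtain ⟨σ, h1, h2, h3, h4, h5⟩ := EnergyArrivals.exists_exhausted_epoch hn.1.1 hd hpd ha ha0
    have hqn : τq ≤ τn := (hq.2 ⟨h1, ⟨h2.le, h4⟩, h5⟩).trans h3
    obtain ⟨τ, hτ, hτf, hτB⟩ := hX.exists_epoch hg hB hΓ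
    have : X.finish = τq := hj
    linarith [hn.2 ⟨hτ, hτB⟩]

/-! ### Uniqueness -/

/-- With nondecreasing powers, the energy curve is below that of any policy over the same span that
uses all available energy at its listed instants. -/
lemma energyUsed_le_energyUsed (hY : Y.EnergyFeasible A) (hmono : Monotone Y.p)
    (hN : Y.start < Y.finish) (hs : X.start = Y.start) (hf : X.finish = Y.finish)
    (hexh : ∀ k, k ≠ 0 → X.energyUsed (X.s k) = A.totalBefore (X.s k)) {t : ℝ}
    (ht : t ∈ Icc X.start X.finish) : Y.energyUsed t ≤ X.energyUsed t := by
  refine le_energyUsed_of_le_grid (fun t ht => ?_) (fun k => ?_) ht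
  · rw [hs, hf] at ht ⊢
    obtain ⟨i, hi⟩ : ∃ i : Fin Y.N, t ∈ Icc (Y.s i.castSucc) (Y.s i.succ) := by
      rcases ht.1.eq_or_lt with h | h
      · obtain ⟨n, hn⟩ : ∃ n, Y.N = n + 1 := Nat.exists_eq_succ_of_ne_zero fun h0 => by
          have : Fin.last Y.N = 0 := Fin.ext (by simp [h0])
          exact hN.ne (congrArg Y.s this).symm
        have h0 : Y.s (Fin.castSucc ⟨0, by omega⟩) = Y.start := rfl
        refine ⟨⟨0, by omega⟩, h0.trans_le h.le, ?_⟩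
        rw [← h]
        exact Y.start_le _
      · obtain ⟨i, hi⟩ := Y.exists_mem_Ioc ⟨h, ht.2⟩
        exact ⟨i, Ioc_subset_Icc_self hi⟩
    exact ⟨Y.p i, fun x hx => energyUsed_support hmono hi hx⟩
  · rcases eq_or_ne k 0 with rfl | hk
    · have : Y.energyUsed (X.s 0) = 0 := Y.energyUsed_of_le_start hs.le
      rw [this]
      exact X.energyUsed_nonneg _
    · rw [hexh k hk]
      exact hY.le_totalBefore
        (X.start_nonneg.trans_lt (X.s_strictMono (Fin.pos_iff_ne_zero.2 hk)))

/-- Two policies with the same instants and the same energy used by them are equal. -/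
lemma eq_of_range_eq (hr : range X.s = range Y.s)
    (hU : ∀ t ∈ range X.s, X.energyUsed t = Y.energyUsed t) : X = Y := by
  have hN : X.N = Y.N := by
    have h1 := Nat.card_range_of_injective X.s_strictMono.injective
    have h2 := Nat.card_range_of_injective Y.s_strictMono.injective
    rw [hr, h2, Nat.card_fin, Nat.card_fin] at h1
    omega
  have hinc : ∀ (Z : Policy) (i : Fin Z.N), Z.energyUsed (Z.s i.succ) =
      Z.energyUsed (Z.s i.castSucc) + Z.p i * (Z.s i.succ - Z.s i.castSucc) := fun Z i =>
    Z.cumulative_of_mem id (right_mem_Icc.2 (Z.castSucc_lt_succ i).le)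
  have hlt := X.castSucc_lt_succ
  have hX := hinc X
  have hY := hinc Y
  obtain ⟨n, p, s, hp, hs, h0⟩ := X
  obtain ⟨m, q, r, hq, hr', h0'⟩ := Y
  obtain rfl : n = m := hN
  obtain rfl : s = r := (hs.range_inj hr').1 hr
  obtain rfl : p = q := by
    funext i
    have h1 := hX i
    have h2 := hY i
    have hlt := hlt i
    dsimp only at h1 h2 hlt
    rw [hU _ ⟨_, rfl⟩, hU _ ⟨_, rfl⟩, h2] at h1
    exact (mul_right_cancel₀ (sub_pos.2 hlt).ne' (add_left_cancel h1)).symm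
  rfl

lemma range_subset_of_energyUsed_eq (hs : X.start = Y.start) (hf : X.finish = Y.finish)
    (hep : ∀ k, k ≠ 0 → k ≠ Fin.last X.N → X.s k ∈ A.epochs)
    (hexh : ∀ k, k ≠ 0 → X.energyUsed (X.s k) = A.totalBefore (X.s k))
    (hU : ∀ t ∈ Icc X.start X.finish, X.energyUsed t = Y.energyUsed t) (hc : Y.Canonical A) :
    range X.s ⊆ range Y.s := by
  rintro _ ⟨k, rfl⟩
  by_cases h0 : k = 0
  · exact ⟨0, by rw [h0]; exact hs.symm⟩
  by_cases h1 : k = Fin.last X.N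
  · exact ⟨Fin.last _, by rw [h1]; exact hf.symm⟩
  refine hc.mem_of_exhausts _ ⟨hs ▸ X.s_strictMono (Fin.pos_iff_ne_zero.2 h0),
    hf ▸ X.s_strictMono (Fin.lt_last_iff_ne_last.2 h1)⟩ ⟨hep k h0 h1, ?_⟩
  rw [← hU _ ⟨X.start_le k, X.le_finish k⟩, hexh k h0]

end Policy

end

/-! ### The characterization -/

theorem theorem1 (A : EnergyArrivals) (g : ℝ → ℝ) (hg : IsRateFunction g)
    (B₀ Γ₀ : ℝ) (hB : 0 < B₀) (hΓ : 0 < Γ₀) :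
    (∀ X : Policy, X.NoBreaks → X.Canonical A → X.EnergyFeasible A →
      (X.IsOptimal A g B₀ Γ₀ ↔
        X.bits g = B₀ ∧
        Monotone X.p ∧
        ((∀ k, k ≠ 0 → k ≠ Fin.last X.N → X.s k ∈ A.epochs) ∧
          ∀ k, k ≠ 0 → X.energyUsed (X.s k) = A.totalBefore (X.s k)) ∧
        ((0 < X.start → X.finish - X.start = Γ₀) ∧ (X.start = 0 → X.finish ≤ Γ₀)) ∧
        ∃ τq, A.IsInitEpoch g B₀ Γ₀ τq ∧
          ∃ j, X.s j = τq ∧ X.energyUsed τq = A.totalBefore τq)) ∧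
    (∀ X Y : Policy, X.NoBreaks → X.Canonical A → X.IsOptimal A g B₀ Γ₀ →
      Y.NoBreaks → Y.Canonical A → Y.IsOptimal A g B₀ Γ₀ → X = Y) := by
  have key : ∀ X : Policy, X.NoBreaks → X.Canonical A → X.IsOptimal A g B₀ Γ₀ →
      X.bits g = B₀ ∧
      Monotone X.p ∧
      ((∀ k, k ≠ 0 → k ≠ Fin.last X.N → X.s k ∈ A.epochs) ∧
        ∀ k, k ≠ 0 → X.energyUsed (X.s k) = A.totalBefore (X.s k)) ∧
      ((0 < X.start → X.finish - X.start = Γ₀) ∧ (X.start = 0 → X.finish ≤ Γ₀)) := by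
    intro X hnb hc hX
    have hN : 0 < X.N := X.N_pos_of_bits_ne_zero (hX.1.bits_eq ▸ hB.ne')
    have hinterior : ∀ k, k ≠ 0 → k ≠ Fin.last X.N → X.ExhaustsAt A (X.s k) := by
      intro k h0 h1
      have hk0 : (k : ℕ) ≠ 0 := fun h => h0 (Fin.ext h)
      have hk1 : (k : ℕ) < X.N := Fin.lt_last_iff_ne_last.2 h1
      exact hX.exhaustsAt hg hB hnb hc (i := ⟨k - 1, by omega⟩) (j := ⟨k, hk1⟩)
        (by simp only; omega)
    have hwin : 0 < X.start → X.finish - X.start = Γ₀ :=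
      hX.finish_sub_start hg hB hnb hc (i := ⟨0, hN⟩) rfl
    refine ⟨hX.1.bits_eq, ?_, ⟨fun k h0 h1 => (hinterior k h0 h1).1, fun k h0 => ?_⟩, hwin,
      fun hs => ?_⟩
    · obtain ⟨n, hn⟩ : ∃ n, X.N = n + 1 := ⟨X.N - 1, by omega⟩
      have hadj : ∀ i j : Fin X.N, (j : ℕ) = i + 1 → X.p i ≤ X.p j :=
        fun i j hij => hX.power_le hg hB hnb hij
      generalize X.p = p at hadj
      generalize X.N = N at hn p hadj
      subst hn
      exact Fin.monotone_iff_le_succ.2 fun i => hadj _ _ (by simp)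
    · by_cases h1 : k = Fin.last X.N
      · rw [h1]
        refine hX.energyUsed_finish hg hB hnb hc (i := ⟨X.N - 1, by omega⟩) ?_
        exact congrArg X.s (Fin.ext (by simp; omega))
      · exact (hinterior k h0 h1).2
    · have := hX.1.onTime_le
      rw [hnb.onTime_eq] at this
      linarith
  refine ⟨fun X hnb hc hE => ⟨fun hX => ?_, ?_⟩, ?_⟩
  · obtain ⟨h1, h2, h3, h4⟩ := key X hnb hc hX
    exact ⟨h1, h2, h3, h4, hX.exists_initEpoch hg hB hΓ hc h3.2 h4.1⟩
  · rintro ⟨h1, h2, h3, h4, τq, hq, j, hj, hU⟩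
    have hfeas : X.Feasible A g B₀ Γ₀ := by
      refine ⟨h1, hE, ?_⟩
      rw [hnb.onTime_eq]
      rcases X.start_eq_or_pos with hs | hs
      · linarith [h4.2 hs.symm]
      · exact (h4.1 hs).le
    refine ⟨hfeas, fun Y hY => hY.finish_le hg hB hnb h1 h2 h3.2 h4.1 fun hs => ⟨j, ?_⟩⟩
    exact Policy.exists_interior_of_isInitEpoch hg hB hΓ hfeas hs hq hj hU
  · intro X Y hXnb hXc hX hYnb hYc hY
    obtain ⟨-, hXm, ⟨hXe, hXx⟩, hX1, hX2⟩ := key X hXnb hXc hX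
    obtain ⟨-, hYm, ⟨hYe, hYx⟩, hY1, hY2⟩ := key Y hYnb hYc hY
    have hf : X.finish = Y.finish := le_antisymm (hX.2 Y hY.1) (hY.2 X hX.1)
    have hs : X.start = Y.start := by
      rcases X.start_eq_or_pos with h | h <;> rcases Y.start_eq_or_pos with h' | h'
      · exact h.symm.trans h'
      · linarith [hX2 h.symm, hY1 h']
      · linarith [hX1 h, hY2 h'.symm]
      · linarith [hX1 h, hY1 h']
    have hlt : ∀ Z : Policy, Z.Feasible A g B₀ Γ₀ → Z.start < Z.finish := by
      intro Z hZ
      refine (Z.le_finish 0).lt_of_ne fun h => ?_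
      have hb := Z.bits_eq g le_rfl
      rw [hZ.bits_eq, Z.cumulative_of_le_start g h.ge] at hb
      exact hB.ne' hb
    have hU : ∀ t ∈ Icc X.start X.finish, X.energyUsed t = Y.energyUsed t := fun t ht =>
      le_antisymm
        (Policy.energyUsed_le_energyUsed hX.1.energy hXm (hlt X hX.1) hs.symm hf.symm hYx
          (hs ▸ hf ▸ ht))
        (Policy.energyUsed_le_energyUsed hY.1.energy hYm (hlt Y hY.1) hs hf hXx ht)
    refine Policy.eq_of_range_eq (Subset.antisymm
      (Policy.range_subset_of_energyUsed_eq hs hf hXe hXx hU hYc)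
      (Policy.range_subset_of_energyUsed_eq hs.symm hf.symm hYe hYx
        (fun t ht => (hU t (by rwa [hs, hf])).symm) hXc)) ?_
    rintro _ ⟨k, rfl⟩
    exact hU _ ⟨X.start_le k, X.le_finish k⟩
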